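/- Let $Z$ be a compact (Hausdorff) abelian group with normalised Haar measure $\mu$. All functions are real valued and measurable and all sets are measurable; $\|\cdot\|_p$ is the norm of $L^p(\mu)$. For $d\ge 1$ put $\widetilde V_d=\{0,1\}^d\setminus\{\vec 0\}$ and $\vec\epsilon\cdot\vec t=\epsilon_1t_1+\dots+\epsilon_dt_d$ for $\vec\epsilon \in\{0,1\}^d$, $\vec t\in Z^d$. The \emph{cubic convolution product} of functions $f_{\vec\epsilon}\in L^{2^{d-1}}(\mu)$, $\vec\epsilon\in\widetilde V_d$, is $$\mathcal D_d(f_{\vec\epsilon}\colon\vec\epsilon\in\widetilde V_d)(x)=\int_{Z^d}\ \prod_{\vec\epsilon\in\widetilde V_d} f_{\vec\epsilon}(x+\vec\epsilon\cdot\vec t)\,d\vec t ,\qquad x\in Z,$$ the integral being with respect to normalised Haar measure on $Z^d$. The space $A(d)$ consists of the functions $g$ on $Z$ that can be written as $$g(x)=\sum_{j=1}^\infty \mathcal D_d(f_{j,\vec\epsilon}\colon\vec\epsilon\in\widetilde V_d)(x)\quad (x\in Z),\qquad f_{j,\vec\epsilon}\in L^{2^{d-1}}(\mu),\qquad \sum_{j=1}^\infty\prod_{\vec\epsilon\in\widetilde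 V_d}\|f_{j,\vec\epsilon}\|_{2^{d-1}}<\infty,$$ and $\|g\|_{A(d)}$ is the infimum of $\sum_j\prod_{\vec\epsilon}\|f_{j,\vec\epsilon}\|_{2^{d-1}}$ over all such representations of $g$. For an integer $m\ge 2$, a partition $(X_1,\dots,X_m)$ of $Z$ (empty classes are allowed) is \emph{almost uniform} if $\mu(X_i)=1/m$ for every $i$ when $Z$ is infinite, and $|X_i|\in\{\lfloor |Z|/m\rfloor,\lceil |Z|/m\rceil\}$ for every $i$ when $Z$ is finite. \textbf{Theorem.} Let $d\ge 1$ be an integer and let $\delta>0$. There exist an integer $M=M(d,\delta)\ge 2$ and a constant $C=C(d,\delta)>0$ such that the following holds for every compact abelian group $Z$. If $f_{\vec\epsilon}$, $\vec\epsilon\in\widetilde V_{d+1}$, are $2^{d+1}-1$ functions in $L^{2^d}(\mu)$ with $\|f_{\vec\epsilon}\|_{2^d}\le 1$ and $\phi=\mathcal D_{d+1}(f_{\vec\epsilon}\colon\vec\epsilon\in\widetilde V_{d+1})$, then there exist an almost uniform partition $(X_1,\dots,X_m)$ of $Z$ with $m\le M$, a nonnegative function $\rho$ on $Z$ and, for every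 $1\le i\le m$ and every $t\in Z$, a function $\phi_i^{(t)}$ on $Z$, such that 1. $\|\rho\|_2\le\delta$; 2. $\|\phi_i^{(t)}\|_\infty\le 1$, $\phi_i^{(t)}\in A(d)$ and $\|\phi_i^{(t)}\|_{A(d)}\le C$ for every $i$ and every $t$; 3. $\displaystyle\Bigl|\phi(x+t)-\sum_{i=1}^m 1_{X_i}(x)\,\phi_i^{(t)}(x)\Bigr|\le\rho(x)$ for all $x,t\in Z$. -/

import Mathlib

open MeasureTheory
open scoped ENNReal

namespace CubicConvolution

/-- Haar measure of a compact abelian group, normalised to have total mass one. It is the regular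
Borel measure constructed by Mathlib. -/
noncomputable def haarProb (G : Type*) [AddCommGroup G] [TopologicalSpace G]
    [IsTopologicalAddGroup G] [CompactSpace G] [MeasurableSpace G] [BorelSpace G] : Measure G :=
  Measure.addHaarMeasure ⊤

/-- Normalised Haar measure of the power `G ^ d`, on the Borel sets of the product topology.
The measurable structure is given explicitly: if `G` is not second countable, the Borel sets of
`G ^ d` need not be the product of the Borel structures of the factors. -/
noncomputable def haarProbPow (G : Type*) [AddCommGroup G] [TopologicalSpace G]
    [IsTopologicalAddGroup G] [CompactSpace G] (d : ℕ) : @Measure (Fin d → G) (borel _) :=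
  @haarProb (Fin d → G) _ _ _ _ (borel _) (@BorelSpace.mk _ _ (borel _) rfl)

/-- The discrete cube `{0,1}^d` without its origin. -/
abbrev PuncturedCube (d : ℕ) : Type := {ε : Fin d → Fin 2 // ε ≠ 0}

/-- `ε · t = ε₁ t₁ + ... + ε_d t_d`. -/
def cubeDot {G : Type*} [AddCommGroup G] {d : ℕ} (ε : Fin d → Fin 2) (t : Fin d → G) : G :=
  ∑ i, (ε i : ℕ) • t i

/-- The cubic convolution product
`D_d(f_ε)(x) = E_{t ∈ G ^ d} ∏_{ε ≠ 0} f_ε (x + ε · t)`. -/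
noncomputable def cubicProd {G : Type*} [AddCommGroup G] [TopologicalSpace G]
    [IsTopologicalAddGroup G] [CompactSpace G] (d : ℕ) (f : PuncturedCube d → G → ℝ) (x : G) : ℝ :=
  @integral (Fin d → G) ℝ _ _ (borel _) (haarProbPow G d)
    (fun t => ∏ ε : PuncturedCube d, f ε (x + cubeDot ε.1 t))

section FourierAlgebra

variable {G : Type*} [AddCommGroup G] [TopologicalSpace G] [IsTopologicalAddGroup G]
  [CompactSpace G] [MeasurableSpace G] [BorelSpace G]

/-- The product over `ε ≠ 0` of the norms of `f_ε` in `L^{2^(d-1)}`. -/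
noncomputable def normProd (d : ℕ) (f : PuncturedCube d → G → ℝ) : ℝ :=
  ∏ ε : PuncturedCube d, (eLpNorm (f ε) (2 ^ (d - 1)) (haarProb G)).toReal

/-- `F` represents `g` as a series of cubic convolution products of functions in `L^{2^(d-1)}`,
with a convergent sum of products of norms. -/
structure Represents (d : ℕ) (F : ℕ → PuncturedCube d → G → ℝ) (g : G → ℝ) : Prop where
  memLp : ∀ j ε, MemLp (F j ε) (2 ^ (d - 1)) (haarProb G)
  summable : Summable fun j => normProd d (F j)
  hasSum : ∀ x, HasSum (fun j => cubicProd d (F j) x) (g x)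

/-- Membership in the Fourier algebra `A(d)` of order `d ≥ 1`. -/
def MemFourierAlgebra (d : ℕ) (g : G → ℝ) : Prop :=
  ∃ F, Represents d F g

/-- The norm of `A(d)`; meaningful for the functions that belong to `A(d)`. -/
noncomputable def fourierAlgebraNorm (d : ℕ) (g : G → ℝ) : ℝ :=
  sInf {c : ℝ | ∃ F, Represents d F g ∧ c = ∑' j, normProd d (F j)}

/-- An almost uniform partition `X_1, ..., X_m` of a compact abelian group, `m ≥ 2`. The classes
have equal Haar measure if the group is infinite; if it is finite, their cardinalities are equal
up to rounding (so some classes are empty when `m` exceeds the order of the group). -/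
structure IsAlmostUniformPartition {m : ℕ} (X : Fin m → Set G) : Prop where
  two_le : 2 ≤ m
  measurableSet : ∀ i, MeasurableSet (X i)
  pairwise_disjoint : Pairwise fun i j => Disjoint (X i) (X j)
  iUnion_eq : ⋃ i, X i = Set.univ
  measure_eq : Infinite G → ∀ i, haarProb G (X i) = 1 / m
  ncard_eq : Finite G → ∀ i,
    (X i).ncard = ⌊(Nat.card G : ℝ) / m⌋₊ ∨ (X i).ncard = ⌈(Nat.card G : ℝ) / m⌉₊

end FourierAlgebra

end CubicConvolution

namespace CubicConvolution

section Haar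

variable {G : Type*} [AddCommGroup G] [TopologicalSpace G] [IsTopologicalAddGroup G]
  [CompactSpace G] [MeasurableSpace G] [BorelSpace G]

instance : (haarProb G).IsAddHaarMeasure := by unfold haarProb; infer_instance

instance : IsProbabilityMeasure (haarProb G) :=
  ⟨by simpa using! Measure.addHaarMeasure_self (K₀ := (⊤ : TopologicalSpace.PositiveCompacts G))⟩

instance : (haarProb G).Regular := by unfold haarProb; infer_instance

/-- A continuous surjective homomorphism of compact groups preserves Haar measure. -/
theorem measurePreserving_haarProb {H : Type*} [AddCommGroup H] [TopologicalSpace H]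
    [IsTopologicalAddGroup H] [CompactSpace H] [MeasurableSpace H] [BorelSpace H]
    (e : G →+ H) (hc : Continuous e) (hs : Function.Surjective e) :
    MeasurePreserving e (haarProb G) (haarProb H) :=
  e.measurePreserving hc hs (by simp)

end Haar

section Continuous

variable {X Y : Type*} [TopologicalSpace X] [TopologicalSpace Y] [CompactSpace Y]
  [MeasurableSpace Y] [OpensMeasurableSpace Y]

theorem continuous_integral_right {ν : Measure Y} [IsFiniteMeasure ν] {f : X → Y → ℝ}
    (hf : Continuous f.uncurry) : Continuous fun x => ∫ y, f x y ∂ν := by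
  rw [← continuousOn_univ]
  exact continuousOn_integral_of_compact_support isCompact_univ hf.continuousOn
    (by simp)

variable [CompactSpace X] [MeasurableSpace X] [OpensMeasurableSpace X]

theorem integrable_of_continuous {μ : Measure X} [IsFiniteMeasure μ] {f : X → ℝ}
    (hf : Continuous f) : Integrable f μ :=
  hf.integrable_of_hasCompactSupport (HasCompactSupport.of_compactSpace f)

theorem integral_swap_of_continuous {μ : Measure X} {ν : Measure Y} [IsFiniteMeasure μ]
    [IsFiniteMeasure ν] {f : X → Y → ℝ} (hf : Continuous f.uncurry) :
    ∫ x, ∫ y, f x y ∂ν ∂μ = ∫ y, ∫ x, f x y ∂μ ∂ν :=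
  integral_integral_swap_of_hasCompactSupport hf (HasCompactSupport.of_compactSpace _)

end Continuous

/-- Haar measure of a compact group onto which a product of two compact groups maps, in terms of
the Haar measures of the factors. -/
theorem integral_haarProb_of_surjective {A B G : Type*}
    [AddCommGroup A] [TopologicalSpace A] [IsTopologicalAddGroup A] [CompactSpace A]
    [MeasurableSpace A] [BorelSpace A]
    [AddCommGroup B] [TopologicalSpace B] [IsTopologicalAddGroup B] [CompactSpace B]
    [MeasurableSpace B] [BorelSpace B]
    [AddCommGroup G] [TopologicalSpace G] [IsTopologicalAddGroup G] [CompactSpace G]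
    [MeasurableSpace G] [BorelSpace G]
    (e : A × B →+ G) (he : Continuous e) (hs : Function.Surjective e) {F : G → ℝ}
    (hF : Continuous F) :
    ∫ g, F g ∂haarProb G = ∫ a, ∫ b, F (e (a, b)) ∂haarProb B ∂haarProb A := by
  have h1 : ∀ a b, ∫ g, F (g + e (a, b)) ∂haarProb G = ∫ g, F g ∂haarProb G := fun a b =>
    integral_add_right_eq_self F (e (a, b))
  have h2 : ∀ g, ∫ a, ∫ b, F (g + e (a, b)) ∂haarProb B ∂haarProb A =
      ∫ a, ∫ b, F (e (a, b)) ∂haarProb B ∂haarProb A := by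
    intro g
    obtain ⟨⟨a₀, b₀⟩, rfl⟩ := hs g
    simp_rw [← map_add, Prod.mk_add_mk]
    rw [← integral_add_left_eq_self (fun a => ∫ b, F (e (a, b)) ∂haarProb B) a₀]
    refine integral_congr_ae (.of_forall fun a => ?_)
    exact integral_add_left_eq_self (fun b => F (e (a₀ + a, b))) b₀
  calc ∫ g, F g ∂haarProb G
      = ∫ a, ∫ b, ∫ g, F (g + e (a, b)) ∂haarProb G ∂haarProb B ∂haarProb A := by simp [h1]
    _ = ∫ a, ∫ g, ∫ b, F (g + e (a, b)) ∂haarProb B ∂haarProb G ∂haarProb A := by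
        refine integral_congr_ae (.of_forall fun a => ?_)
        exact integral_swap_of_continuous (f := fun b g => F (g + e (a, b))) (by
          simp only [Function.uncurry_def]; fun_prop)
    _ = ∫ g, ∫ a, ∫ b, F (g + e (a, b)) ∂haarProb B ∂haarProb A ∂haarProb G := by
        refine integral_swap_of_continuous (f := fun a g => ∫ b, F (g + e (a, b)) ∂haarProb B) ?_
        refine continuous_integral_right (f := fun (p : A × G) b => F (p.2 + e (p.1, b))) ?_
        simp only [Function.uncurry_def]; fun_prop
    _ = _ := by simp [h2]

/-- The power `G ^ d`, with its Borel structure. -/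
def CubePow (G : Type*) (d : ℕ) : Type _ := Fin d → G

namespace CubePow

variable {G : Type*} [AddCommGroup G] {d : ℕ}

instance : AddCommGroup (CubePow G d) := inferInstanceAs (AddCommGroup (Fin d → G))

/-- `t ↦ ε · t` as a homomorphism. -/
def dot (ε : Fin d → Fin 2) : CubePow G d →+ G where
  toFun t := cubeDot ε t
  map_zero' := by
    simp only [cubeDot]
    exact Finset.sum_eq_zero fun i _ => smul_zero _
  map_add' s t := by
    simp only [cubeDot]
    rw [← Finset.sum_add_distrib]
    exact Finset.sum_congr rfl fun i _ => smul_add _ _ _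

theorem surjective_dot {ε : Fin d → Fin 2} (hε : ε ≠ 0) : Function.Surjective (dot (G := G) ε) := by
  obtain ⟨i, hi⟩ := Function.ne_iff.1 hε
  have hi : (ε i : ℕ) = 1 := by
    have := (ε i).2
    have h0 : (ε i : ℕ) ≠ 0 := fun h => hi (Fin.ext h)
    omega
  intro x
  refine ⟨(Pi.single i x : Fin d → G), ?_⟩
  change ∑ j, (ε j : ℕ) • (Pi.single i x : Fin d → G) j = x
  rw [Finset.sum_eq_single i (fun j _ hj => by simp [hj]) (by simp)]
  simp [hi]

/-- Prepending a coordinate. -/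
def cons : G × CubePow G d →+ CubePow G (d + 1) where
  toFun p := (Fin.cons p.1 p.2 : Fin (d + 1) → G)
  map_zero' := by
    funext i
    refine Fin.cases ?_ (fun j => ?_) i <;> rfl
  map_add' p q := by
    funext i
    refine Fin.cases ?_ (fun j => ?_) i <;> rfl

theorem surjective_cons : Function.Surjective (cons (G := G) (d := d)) := fun t =>
  ⟨((t : Fin (d + 1) → G) 0, (Fin.tail t : Fin d → G)), Fin.cons_self_tail t⟩

theorem dot_cons (a : Fin 2) (η : Fin d → Fin 2) (p : G × CubePow G d) :
    dot (Fin.cons a η : Fin (d + 1) → Fin 2) (cons p) = (a : ℕ) • p.1 + dot η p.2 := by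
  change ∑ i, ((Fin.cons a η : Fin (d + 1) → Fin 2) i : ℕ) •
    (Fin.cons p.1 p.2 : Fin (d + 1) → G) i = _
  rw [Fin.sum_univ_succ]
  rfl

variable [TopologicalSpace G]

instance : TopologicalSpace (CubePow G d) := inferInstanceAs (TopologicalSpace (Fin d → G))
instance [IsTopologicalAddGroup G] : IsTopologicalAddGroup (CubePow G d) :=
  inferInstanceAs (IsTopologicalAddGroup (Fin d → G))
instance [CompactSpace G] : CompactSpace (CubePow G d) :=
  inferInstanceAs (CompactSpace (Fin d → G))
instance : MeasurableSpace (CubePow G d) := borel _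
instance : BorelSpace (CubePow G d) := ⟨rfl⟩

theorem continuous_dot [IsTopologicalAddGroup G] (ε : Fin d → Fin 2) :
    Continuous (dot (G := G) ε) := by
  change Continuous fun t : Fin d → G => ∑ i, (ε i : ℕ) • t i
  fun_prop

theorem continuous_cons : Continuous (cons (G := G) (d := d)) := by
  change Continuous fun p : G × (Fin d → G) => (Fin.cons p.1 p.2 : Fin (d + 1) → G)
  fun_prop

end CubePow

/-- The vertex `(0, η)` of the cube. -/
def PuncturedCube.low {d : ℕ} (η : PuncturedCube d) : PuncturedCube (d + 1) :=
  ⟨(Fin.cons 0 η.1 : Fin (d + 1) → Fin 2), fun h => η.2 (by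
    funext i; simpa using congrFun h i.succ)⟩

/-- The vertex `(1, η)` of the cube. -/
def PuncturedCube.high {d : ℕ} (η : Fin d → Fin 2) : PuncturedCube (d + 1) :=
  ⟨(Fin.cons 1 η : Fin (d + 1) → Fin 2), fun h => by simpa using congrFun h 0⟩

theorem PuncturedCube.prod_succ {M : Type*} [CommMonoid M] {d : ℕ} (F : PuncturedCube (d + 1) → M) :
    ∏ ε, F ε = F (.high 0) * ∏ η : PuncturedCube d, F (.low η) * F (.high η.1) := by
  classical
  have key : ∀ (n : ℕ) (H : PuncturedCube n → M),
      ∏ ε, H ε = ∏ ε : Fin n → Fin 2, if h : ε ≠ 0 then H ⟨ε, h⟩ else 1 := by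
    intro n H
    rw [Finset.prod_dite]
    simp only [Finset.prod_const_one, mul_one]
    refine (Finset.prod_bij (fun ε _ => ⟨ε.1, by simpa using ε.2⟩) ?_ ?_ ?_ ?_)
    · simp
    · intro a _ b _ h
      exact Subtype.ext (by simpa using h)
    · intro b _
      exact ⟨⟨b.1, (Finset.mem_filter.1 b.2).2⟩, by simp, rfl⟩
    · simp
  have h1 : ∏ η : Fin d → Fin 2, F (.high η) =
      F (.high 0) * ∏ η : PuncturedCube d, F (.high η.1) := by
    rw [key d, ← Finset.mul_prod_erase _ _ (Finset.mem_univ 0)]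
    congr 1
    rw [← Finset.mul_prod_erase _ (fun ε => dite _ _ _) (Finset.mem_univ 0)]
    simp only [ne_eq, not_true_eq_false, dite_false, one_mul]
    exact Finset.prod_congr rfl fun η hη => by simp [Finset.ne_of_mem_erase hη]
  rw [Finset.prod_mul_distrib, mul_left_comm, ← h1, key, key,
    ← (Fin.consEquiv fun _ => Fin 2).prod_comp, Fintype.prod_prod_type, Fin.prod_univ_two]
  congr 1
  · refine Finset.prod_congr rfl fun η _ => ?_
    have : ((Fin.consEquiv fun _ : Fin (d + 1) => Fin 2) (0, η) ≠ 0) ↔ η ≠ 0 := by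
      rw [not_iff_not]
      constructor
      · intro h; funext i; simpa using congrFun h i.succ
      · rintro rfl; funext i; refine Fin.cases ?_ (fun j => ?_) i <;> rfl
    by_cases h : η = 0
    · rw [dif_neg (by rw [this]; simpa using h), dif_neg (by simpa using h)]
    · rw [dif_pos (this.2 h), dif_pos h]; rfl
  · refine Finset.prod_congr rfl fun η _ => ?_
    have : (Fin.consEquiv fun _ : Fin (d + 1) => Fin 2) (1, η) ≠ 0 := fun h => by
      simpa using congrFun h 0
    rw [dif_pos this]; rfl

open PuncturedCube

section Norms

variable {G : Type*} [AddCommGroup G] [TopologicalSpace G] [IsTopologicalAddGroup G]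
  [CompactSpace G] [MeasurableSpace G] [BorelSpace G]

theorem memLp_of_continuous {f : G → ℝ} (hf : Continuous f) (p : ℝ≥0∞) : MemLp f p (haarProb G) := by
  obtain ⟨C, hC⟩ := isCompact_univ.exists_bound_of_continuousOn hf.continuousOn
  exact MemLp.of_bound (integrable_of_continuous hf).1 C (.of_forall fun x => hC x trivial)

theorem eLpNorm_translate {f : G → ℝ} (hf : AEStronglyMeasurable f (haarProb G)) (p : ℝ≥0∞)
    (t : G) : eLpNorm (fun x => f (x + t)) p (haarProb G) = eLpNorm f p (haarProb G) :=
  eLpNorm_comp_measurePreserving hf (measurePreserving_add_right (haarProb G) t)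

theorem one_le_two_pow_ennreal (d : ℕ) : (1 : ℝ≥0∞) ≤ 2 ^ d :=
  one_le_pow_of_one_le' (by norm_num) d

theorem eLpNorm_mul_le_two_pow {f g : G → ℝ} (hf : AEStronglyMeasurable f (haarProb G))
    (hg : AEStronglyMeasurable g (haarProb G)) (d : ℕ) :
    eLpNorm (fun x => f x * g x) (2 ^ d) (haarProb G) ≤
      eLpNorm f (2 ^ (d + 1)) (haarProb G) * eLpNorm g (2 ^ (d + 1)) (haarProb G) := by
  have : ENNReal.HolderTriple (2 ^ (d + 1)) (2 ^ (d + 1)) (2 ^ d) := ⟨by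
    have h : ((2 : ℝ≥0∞) ^ (d + 1))⁻¹ = 2⁻¹ * (2 ^ d)⁻¹ := by
      rw [pow_succ', ENNReal.mul_inv (Or.inl two_ne_zero) (Or.inl ENNReal.ofNat_ne_top)]
    rw [h, ← add_mul, ENNReal.inv_two_add_inv_two, one_mul]⟩
  have h : eLpNorm (f • g) (2 ^ d) (haarProb G) ≤
      eLpNorm f (2 ^ (d + 1)) (haarProb G) * eLpNorm g (2 ^ (d + 1)) (haarProb G) :=
    eLpNorm_smul_le_mul_eLpNorm hg hf
  exact h

theorem integral_abs_le_eLpNorm {f : G → ℝ} (hf : Continuous f) (d : ℕ) :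
    ∫ x, |f x| ∂haarProb G ≤ (eLpNorm f (2 ^ d) (haarProb G)).toReal := by
  have h1 : ∫ x, |f x| ∂haarProb G = (eLpNorm f 1 (haarProb G)).toReal := by
    rw [eLpNorm_one_eq_lintegral_enorm, ← integral_norm_eq_lintegral_enorm
      (memLp_of_continuous hf 1).1]
    rfl
  rw [h1]
  exact ENNReal.toReal_mono (memLp_of_continuous hf _).2.ne
    (eLpNorm_le_eLpNorm_of_exponent_le (one_le_two_pow_ennreal d) (memLp_of_continuous hf 1).1)

theorem normProd_nonneg (d : ℕ) (f : PuncturedCube d → G → ℝ) : 0 ≤ normProd d f :=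
  Finset.prod_nonneg fun _ _ => ENNReal.toReal_nonneg

theorem normProd_le_one {d : ℕ} {f : PuncturedCube d → G → ℝ}
    (h : ∀ ε, eLpNorm (f ε) (2 ^ (d - 1)) (haarProb G) ≤ 1) : normProd d f ≤ 1 :=
  Finset.prod_le_one (fun _ _ => ENNReal.toReal_nonneg) fun ε _ => by
    simpa using ENNReal.toReal_mono ENNReal.one_ne_top (h ε)

end Norms

section Recursion

variable {G : Type*} [AddCommGroup G] [TopologicalSpace G] [IsTopologicalAddGroup G]
  [CompactSpace G] {d : ℕ}

theorem cubicProd_eq (f : PuncturedCube d → G → ℝ) (x : G) :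
    cubicProd d f x =
      ∫ t : CubePow G d, ∏ ε, f ε (x + CubePow.dot ε.1 t) ∂haarProb (CubePow G d) := rfl

variable [MeasurableSpace G] [BorelSpace G]

theorem cubicProd_succ {f : PuncturedCube (d + 1) → G → ℝ} (hf : ∀ ε, Continuous (f ε))
    (x t : G) :
    cubicProd (d + 1) f (x + t) = ∫ u, f (high 0) (x + u) *
      cubicProd d (fun η y => f η.low (y + t) * f (high η.1) (y + u)) x ∂haarProb G := by
  rw [cubicProd_eq, integral_haarProb_of_surjective CubePow.cons CubePow.continuous_cons
    CubePow.surjective_cons]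
  · refine Eq.trans ?_ (integral_add_left_eq_self (fun u => f (high 0) (x + u) *
      cubicProd d (fun η y => f η.low (y + t) * f (high η.1) (y + u)) x) t)
    refine integral_congr_ae (.of_forall fun u => ?_)
    dsimp only
    rw [cubicProd_eq, ← integral_const_mul]
    refine integral_congr_ae (.of_forall fun s => ?_)
    dsimp only
    rw [prod_succ]
    have h0 : CubePow.dot (G := G) (0 : Fin d → Fin 2) s = 0 :=
      by
      change ∑ i, ((0 : Fin d → Fin 2) i : ℕ) • s i = 0
      simp
    congr 1
    · rw [high, CubePow.dot_cons, h0]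
      simp [add_assoc]
    · refine Finset.prod_congr rfl fun η _ => ?_
      simp only [high, low, CubePow.dot_cons]
      congr 2
      · simp; abel
      · simp; abel
  · refine continuous_finsetProd _ fun ε _ => (hf ε).comp ?_
    have := CubePow.continuous_dot (G := G) ε.1
    fun_prop

/-- The cubic convolution product of continuous functions is bounded by the product of norms. -/
theorem abs_cubicProd_le_of_continuous (hd : 1 ≤ d) {f : PuncturedCube d → G → ℝ}
    (hf : ∀ ε, Continuous (f ε)) (x : G) : |cubicProd d f x| ≤ normProd d f := by
  induction d, hd using Nat.le_induction generalizing x with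
  | base =>
    have h := cubicProd_succ (d := 0) hf x 0
    have h0 : IsEmpty (PuncturedCube 0) := ⟨fun η => η.2 (Subsingleton.elim _ _)⟩
    have h1 : ∀ g : PuncturedCube 0 → G → ℝ, cubicProd 0 g x = 1 := fun g => by
      simp [cubicProd_eq]
    simp only [add_zero, h1, mul_one] at h
    rw [h, normProd, prod_succ, Finset.univ_eq_empty, Finset.prod_empty, mul_one]
    calc _ ≤ ∫ u, |f (high 0) (x + u)| ∂haarProb G := abs_integral_le_integral_abs
      _ = ∫ u, |f (high 0) u| ∂haarProb G :=
        integral_add_left_eq_self (fun u => |f (high 0) u|) x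
      _ ≤ _ := integral_abs_le_eLpNorm (hf _) 0
  | succ d hd ih =>
    have hc : ∀ u, ∀ η : PuncturedCube d,
        Continuous fun y => f η.low (y + 0) * f (high η.1) (y + u) := fun u η => by
      have h1 := hf η.low
      have h2 := hf (high η.1)
      fun_prop
    set N : (G → ℝ) → ℝ := fun g => (eLpNorm g (2 ^ d) (haarProb G)).toReal
    have hN : ∀ u, normProd d (fun η y => f η.low (y + 0) * f (high η.1) (y + u)) ≤
        ∏ η : PuncturedCube d, N (f η.low) * N (f (high η.1)) := by
      intro u
      refine Finset.prod_le_prod (fun _ _ => ENNReal.toReal_nonneg) fun η _ => ?_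
      rw [← ENNReal.toReal_mul]
      refine ENNReal.toReal_mono (ENNReal.mul_ne_top (memLp_of_continuous (hf _) _).2.ne
        (memLp_of_continuous (hf _) _).2.ne) ?_
      have h2 := hf (high η.1)
      have := eLpNorm_mul_le_two_pow (memLp_of_continuous (hf η.low) 1).1
        (memLp_of_continuous (f := fun y => f (high η.1) (y + u)) (by fun_prop) 1).1 (d - 1)
      rw [Nat.sub_add_cancel hd, eLpNorm_translate (memLp_of_continuous (hf _) 1).1] at this
      simpa using this
    have h := cubicProd_succ hf x 0
    rw [add_zero] at h
    rw [h]
    have hc' : Continuous (f (high 0)) := hf _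
    calc _ ≤ ∫ u, |f (high 0) (x + u)| *
            ∏ η : PuncturedCube d, N (f η.low) * N (f (high η.1)) ∂haarProb G := by
          refine (abs_integral_le_integral_abs).trans (integral_mono_of_nonneg
            (.of_forall fun _ => abs_nonneg _) (integrable_of_continuous (by fun_prop))
            (.of_forall fun u => ?_))
          dsimp only
          rw [abs_mul]
          exact mul_le_mul_of_nonneg_left ((ih (hc u) x).trans (hN u)) (abs_nonneg _)
      _ = (∫ u, |f (high 0) u| ∂haarProb G) *
            ∏ η : PuncturedCube d, N (f η.low) * N (f (high η.1)) := by
          rw [integral_mul_const, integral_add_left_eq_self (fun u => |f (high 0) u|) x]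
      _ ≤ N (f (high 0)) * ∏ η : PuncturedCube d, N (f η.low) * N (f (high η.1)) :=
          mul_le_mul_of_nonneg_right (integral_abs_le_eLpNorm (hf _) d)
            (Finset.prod_nonneg fun _ _ => mul_nonneg ENNReal.toReal_nonneg ENNReal.toReal_nonneg)
      _ = _ := by rw [normProd, prod_succ]; rfl

end Recursion

open Filter Topology

open Classical in
theorem prod_update_apply {G : Type*} {d : ℕ} (f : PuncturedCube d → G → ℝ) (a : PuncturedCube d) (g : G → ℝ)
    (y : PuncturedCube d → G) :
    ∏ ε, Function.update f a g ε (y ε) = g (y a) * ∏ ε ∈ Finset.univ.erase a, f ε (y ε) := by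
  rw [← Finset.mul_prod_erase _ _ (Finset.mem_univ a)]
  simp only [Function.update_self]
  congr 1
  exact Finset.prod_congr rfl fun ε hε => by
    rw [Function.update_of_ne (Finset.ne_of_mem_erase hε)]

section General

variable {G : Type*} [AddCommGroup G] [TopologicalSpace G] [IsTopologicalAddGroup G]
  [CompactSpace G] {d : ℕ}

open Classical in
theorem cubicProd_update_mul (f : PuncturedCube d → G → ℝ) (a : PuncturedCube d) (r : ℝ) (x : G) :
    cubicProd d (Function.update f a fun y => r * f a y) x = r * cubicProd d f x := by
  simp only [cubicProd_eq]
  rw [← integral_const_mul]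
  refine integral_congr_ae (.of_forall fun t => ?_)
  dsimp only
  rw [prod_update_apply f a _ fun ε => x + CubePow.dot ε.1 t,
    ← Finset.mul_prod_erase _ (fun ε => f ε (x + CubePow.dot ε.1 t)) (Finset.mem_univ a)]
  ring

variable [MeasurableSpace G] [BorelSpace G]

theorem exists_continuous_eLpNorm_sub_le [T2Space G] {f : G → ℝ} {p : ℝ≥0∞}
    (hf : MemLp f p (haarProb G)) (hp : p ≠ ⊤) {η : ℝ≥0∞} (hη : η ≠ 0) :
    ∃ c : G → ℝ, Continuous c ∧ eLpNorm (fun x => f x - c x) p (haarProb G) ≤ η := by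
  obtain ⟨c, hc, -⟩ := hf.exists_boundedContinuous_eLpNorm_sub_le hp hη
  exact ⟨c, c.continuous, hc⟩

theorem exists_continuous_seq_tendsto [T2Space G] {f : G → ℝ} {p : ℝ≥0∞}
    (hf : MemLp f p (haarProb G)) (hp : p ≠ ⊤) (hp1 : 1 ≤ p) :
    ∃ c : ℕ → G → ℝ, (∀ n, Continuous (c n)) ∧
      Tendsto (fun n => eLpNorm (f - c n) p (haarProb G)) atTop (𝓝 0) ∧
      ∀ᵐ x ∂haarProb G, Tendsto (fun n => c n x) atTop (𝓝 (f x)) := by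
  have h : ∀ n : ℕ, ∃ c : G → ℝ, Continuous c ∧
      eLpNorm (f - c) p (haarProb G) ≤ ((n : ℝ≥0∞) + 1)⁻¹ := fun n =>
    exists_continuous_eLpNorm_sub_le hf hp (ENNReal.inv_ne_zero.2 (by finiteness))
  choose c hc hcn using h
  have h0 : Tendsto (fun n => eLpNorm (f - c n) p (haarProb G)) atTop (𝓝 0) := by
    refine tendsto_of_tendsto_of_tendsto_of_le_of_le tendsto_const_nhds ?_ (fun _ => zero_le) hcn
    have := (tendsto_add_atTop_iff_nat 1).2 ENNReal.tendsto_inv_nat_nhds_zero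
    simpa using this
  have h1 : TendstoInMeasure (haarProb G) c atTop f := by
    refine tendstoInMeasure_of_tendsto_eLpNorm (p := p) (by positivity)
      (fun n => (memLp_of_continuous (hc n) p).1) hf.1 ?_
    simpa only [eLpNorm_sub_comm] using h0
  obtain ⟨ns, hns, hae⟩ := h1.exists_seq_tendsto_ae
  exact ⟨fun n => c (ns n), fun n => hc _, h0.comp hns.tendsto_atTop, hae⟩

theorem measurePreserving_add_dot {ε : Fin d → Fin 2} (hε : ε ≠ 0) (x : G) :
    MeasurePreserving (fun t : CubePow G d => x + CubePow.dot ε t) (haarProb (CubePow G d))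
      (haarProb G) :=
  (measurePreserving_add_left (haarProb G) x).comp
    (measurePreserving_haarProb _ (CubePow.continuous_dot ε) (CubePow.surjective_dot hε))

theorem enorm_prod_real {ι : Type*} (s : Finset ι) (f : ι → ℝ) :
    ‖∏ i ∈ s, f i‖ₑ = ∏ i ∈ s, ‖f i‖ₑ := by
  classical
  induction s using Finset.induction_on with
  | empty => simp
  | insert a s ha ih => rw [Finset.prod_insert ha, Finset.prod_insert ha, enorm_mul, ih]

theorem lintegral_prod_enorm_le_of_continuous (hd : 1 ≤ d) {f : PuncturedCube d → G → ℝ}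
    (hf : ∀ ε, Continuous (f ε)) (x : G) :
    ∫⁻ t : CubePow G d, ∏ ε, ‖f ε (x + CubePow.dot ε.1 t)‖ₑ ∂haarProb (CubePow G d) ≤
      ∏ ε, eLpNorm (f ε) (2 ^ (d - 1)) (haarProb G) := by
  have h := abs_cubicProd_le_of_continuous hd (f := fun ε y => |f ε y|) (fun ε => (hf ε).abs) x
  have h1 : normProd d (fun ε y => |f ε y|) =
      (∏ ε, eLpNorm (f ε) (2 ^ (d - 1)) (haarProb G)).toReal := by
    rw [ENNReal.toReal_prod, normProd]
    exact Finset.prod_congr rfl fun ε _ => congrArg _ (eLpNorm_norm (f ε))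
  have hcont : Continuous fun t : CubePow G d => ∏ ε, f ε (x + CubePow.dot ε.1 t) := by
    refine continuous_finsetProd _ fun ε _ => (hf ε).comp ?_
    have := CubePow.continuous_dot (G := G) ε.1
    fun_prop
  have h2 : ∫⁻ t : CubePow G d, ∏ ε, ‖f ε (x + CubePow.dot ε.1 t)‖ₑ ∂haarProb (CubePow G d) =
      ENNReal.ofReal (cubicProd d (fun ε y => |f ε y|) x) := by
    have := ofReal_integral_norm_eq_lintegral_enorm
      (integrable_of_continuous (μ := haarProb (CubePow G d)) hcont)
    simp only [enorm_prod_real, norm_prod] at this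
    exact this.symm
  rw [h2, ENNReal.ofReal_le_iff_le_toReal
    (ENNReal.prod_ne_top fun ε _ => (memLp_of_continuous (hf ε) _).2.ne), ← h1]
  exact (le_abs_self _).trans h

theorem lintegral_prod_enorm_le [T2Space G] (hd : 1 ≤ d) {f : PuncturedCube d → G → ℝ}
    (hf : ∀ ε, MemLp (f ε) (2 ^ (d - 1)) (haarProb G)) (x : G) :
    ∫⁻ t : CubePow G d, ∏ ε, ‖f ε (x + CubePow.dot ε.1 t)‖ₑ ∂haarProb (CubePow G d) ≤
      ∏ ε, eLpNorm (f ε) (2 ^ (d - 1)) (haarProb G) := by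
  have happrox := fun ε => exists_continuous_seq_tendsto (p := 2 ^ (d - 1)) (hf ε) (by finiteness)
    (one_le_two_pow_ennreal (d - 1))
  choose c hc hc0 hcae using happrox
  have hae : ∀ᵐ t ∂haarProb (CubePow G d), ∀ ε : PuncturedCube d,
      Tendsto (fun n => c ε n (x + CubePow.dot ε.1 t)) atTop
        (𝓝 (f ε (x + CubePow.dot ε.1 t))) := by
    rw [ae_all_iff]
    intro ε
    have hq := (measurePreserving_add_dot ε.2 x).quasiMeasurePreserving
    exact hq.ae (p := fun y => Tendsto (fun n => c ε n y) atTop (𝓝 (f ε y))) (hcae ε)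
  have hcm : ∀ n, Measurable fun t : CubePow G d => ∏ ε, ‖c ε n (x + CubePow.dot ε.1 t)‖ₑ := by
    intro n
    refine Finset.measurable_fun_prod _ fun ε _ => ?_
    exact ((hc ε n).measurable.comp (measurePreserving_add_dot ε.2 x).measurable).enorm
  calc _ = ∫⁻ t : CubePow G d, liminf (fun n => ∏ ε, ‖c ε n (x + CubePow.dot ε.1 t)‖ₑ) atTop
          ∂haarProb (CubePow G d) := by
        refine lintegral_congr_ae (hae.mono fun t ht => ?_)
        refine (Tendsto.liminf_eq ?_).symm
        refine ENNReal.tendsto_finsetProd_of_ne_top _ (fun ε _ => ?_) (fun ε _ => by finiteness)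
        exact (ht ε).enorm
    _ ≤ liminf (fun n => ∫⁻ t : CubePow G d, ∏ ε, ‖c ε n (x + CubePow.dot ε.1 t)‖ₑ
          ∂haarProb (CubePow G d)) atTop := lintegral_liminf_le hcm
    _ ≤ liminf (fun n => ∏ ε, (eLpNorm (f ε) (2 ^ (d - 1)) (haarProb G) +
          eLpNorm (f ε - c ε n) (2 ^ (d - 1)) (haarProb G))) atTop := by
        refine liminf_le_liminf (.of_forall fun n => ?_)
        refine (lintegral_prod_enorm_le_of_continuous hd (fun ε => hc ε n) x).trans
          (Finset.prod_le_prod' fun ε _ => ?_)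
        have hcf := (memLp_of_continuous (hc ε n) (2 ^ (d - 1))).1
        have := eLpNorm_sub_le (hf ε).1 ((hf ε).1.sub hcf) (one_le_two_pow_ennreal (d - 1))
        rwa [sub_sub_cancel] at this
    _ = _ := by
        refine Tendsto.liminf_eq (ENNReal.tendsto_finsetProd_of_ne_top _ (fun ε _ => ?_)
          (fun ε _ => (hf ε).2.ne))
        simpa using tendsto_const_nhds.add (hc0 ε)

open Classical in
theorem memLp_update {f : PuncturedCube d → G → ℝ} {p : ℝ≥0∞}
    (hf : ∀ ε, MemLp (f ε) p (haarProb G)) {g : G → ℝ} (hg : MemLp g p (haarProb G))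
    (a ε : PuncturedCube d) : MemLp (Function.update f a g ε) p (haarProb G) := by
  by_cases h : ε = a
  · subst h; simpa
  · simpa [h] using hf ε

variable [T2Space G]

theorem integrable_prod (hd : 1 ≤ d) {f : PuncturedCube d → G → ℝ}
    (hf : ∀ ε, MemLp (f ε) (2 ^ (d - 1)) (haarProb G)) (x : G) :
    Integrable (fun t : CubePow G d => ∏ ε, f ε (x + CubePow.dot ε.1 t))
      (haarProb (CubePow G d)) := by
  refine ⟨Finset.aestronglyMeasurable_fun_prod _ fun ε _ =>
    (hf ε).1.comp_measurePreserving (measurePreserving_add_dot ε.2 x), ?_⟩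
  rw [hasFiniteIntegral_iff_enorm]
  simp only [enorm_prod_real]
  exact (lintegral_prod_enorm_le hd hf x).trans_lt
    (ENNReal.prod_lt_top fun ε _ => (hf ε).2)

theorem abs_cubicProd_le (hd : 1 ≤ d) {f : PuncturedCube d → G → ℝ}
    (hf : ∀ ε, MemLp (f ε) (2 ^ (d - 1)) (haarProb G)) (x : G) :
    |cubicProd d f x| ≤ normProd d f := by
  rw [cubicProd_eq]
  rw [← Real.norm_eq_abs]
  refine (norm_integral_le_integral_norm _).trans ?_
  rw [integral_norm_eq_lintegral_enorm (integrable_prod hd hf x).1]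
  simp only [enorm_prod_real]
  rw [normProd, ← ENNReal.toReal_prod]
  exact ENNReal.toReal_mono (ENNReal.prod_ne_top fun ε _ => (hf ε).2.ne)
    (lintegral_prod_enorm_le hd hf x)

open Classical in
theorem cubicProd_update_sub (hd : 1 ≤ d) {f : PuncturedCube d → G → ℝ}
    (hf : ∀ ε, MemLp (f ε) (2 ^ (d - 1)) (haarProb G)) {g h : G → ℝ}
    (hg : MemLp g (2 ^ (d - 1)) (haarProb G)) (hh : MemLp h (2 ^ (d - 1)) (haarProb G))
    (a : PuncturedCube d) (x : G) :
    cubicProd d (Function.update f a fun y => g y - h y) x =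
      cubicProd d (Function.update f a g) x - cubicProd d (Function.update f a h) x := by
  simp only [cubicProd_eq]
  rw [← integral_sub (integrable_prod hd (memLp_update hf hg a) x)
    (integrable_prod hd (memLp_update hf hh a) x)]
  refine integral_congr_ae (.of_forall fun t => ?_)
  dsimp only
  simp only [prod_update_apply f a _ fun ε => x + CubePow.dot ε.1 t]
  ring

/-- Stability of the cubic convolution product under small perturbations of all the factors. -/
theorem abs_cubicProd_sub_le (hd : 1 ≤ d) {f g : PuncturedCube d → G → ℝ}
    (hf : ∀ ε, MemLp (f ε) (2 ^ (d - 1)) (haarProb G))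
    (hg : ∀ ε, MemLp (g ε) (2 ^ (d - 1)) (haarProb G))
    (hf1 : ∀ ε, eLpNorm (f ε) (2 ^ (d - 1)) (haarProb G) ≤ 1)
    (hg1 : ∀ ε, eLpNorm (g ε) (2 ^ (d - 1)) (haarProb G) ≤ 1) {η : ℝ} (hη : 0 ≤ η)
    (hfg : ∀ ε, eLpNorm (fun x => f ε x - g ε x) (2 ^ (d - 1)) (haarProb G) ≤ ENNReal.ofReal η)
    (x : G) :
    |cubicProd d f x - cubicProd d g x| ≤ Fintype.card (PuncturedCube d) * η := by
  classical
  suffices h : ∀ S : Finset (PuncturedCube d),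
      |cubicProd d f x - cubicProd d (fun ε => if ε ∈ S then g ε else f ε) x| ≤ S.card * η by
    simpa using h Finset.univ
  intro S
  induction S using Finset.induction_on with
  | empty => simp
  | insert a S ha ih =>
    set k : PuncturedCube d → G → ℝ := fun ε => if ε ∈ S then g ε else f ε with hk
    have hkm : ∀ ε, MemLp (k ε) (2 ^ (d - 1)) (haarProb G) := fun ε => by
      by_cases h : ε ∈ S <;> simp [hk, h, hf, hg]
    have hk1 : ∀ ε, eLpNorm (k ε) (2 ^ (d - 1)) (haarProb G) ≤ 1 := fun ε => by
      by_cases h : ε ∈ S <;> simp [hk, h, hf1, hg1]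
    have e1 : Function.update k a (f a) = k := by
      rw [Function.update_eq_self_iff]; simp [hk, ha]
    have e2 : Function.update k a (g a) = fun ε => if ε ∈ insert a S then g ε else f ε := by
      funext ε
      by_cases h : ε = a
      · subst h; simp
      · simp [h, hk]
    have key := cubicProd_update_sub hd hkm (hf a) (hg a) a x
    rw [e1, e2] at key
    have hbound : |cubicProd d (Function.update k a fun y => f a y - g a y) x| ≤ η := by
      refine (abs_cubicProd_le hd (memLp_update hkm ((hf a).sub (hg a)) a) x).trans ?_
      rw [normProd, ← Finset.mul_prod_erase _ _ (Finset.mem_univ a)]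
      have h1 : (eLpNorm (Function.update k a (fun y => f a y - g a y) a) (2 ^ (d - 1))
          (haarProb G)).toReal ≤ η := by
        rw [Function.update_self]
        exact ENNReal.toReal_le_of_le_ofReal hη (hfg a)
      have h2 : ∏ ε ∈ Finset.univ.erase a, (eLpNorm (Function.update k a
          (fun y => f a y - g a y) ε) (2 ^ (d - 1)) (haarProb G)).toReal ≤ 1 := by
        refine Finset.prod_le_one (fun _ _ => ENNReal.toReal_nonneg) fun ε hε => ?_
        rw [Function.update_of_ne (Finset.ne_of_mem_erase hε)]
        simpa using ENNReal.toReal_mono ENNReal.one_ne_top (hk1 ε)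
      calc _ ≤ η * 1 := mul_le_mul h1 h2
            (Finset.prod_nonneg fun _ _ => ENNReal.toReal_nonneg) hη
        _ = η := mul_one _
    rw [Finset.card_insert_of_notMem ha]
    push_cast
    have := abs_add_le (cubicProd d f x - cubicProd d k x)
      (cubicProd d k x - cubicProd d (fun ε => if ε ∈ insert a S then g ε else f ε) x)
    rw [← key, sub_add_eq_add_sub, key] at this
    have h3 : cubicProd d f x - cubicProd d (fun ε => if ε ∈ insert a S then g ε else f ε) x =
      (cubicProd d f x - cubicProd d k x) +
        cubicProd d (Function.update k a fun y => f a y - g a y) x := by rw [key]; ring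
    rw [h3]
    refine (abs_add_le _ _).trans ?_
    linarith

end General

section Sampling

variable {X K : Type*} [TopologicalSpace X] [CompactSpace X] [MeasurableSpace X]
  [OpensMeasurableSpace X] {μ : Measure X} [IsProbabilityMeasure μ]

theorem integral_sq_add_sub_integral_le {f : X → ℝ} (hf : Continuous f) (s : ℝ) :
    ∫ x, (s + f x - ∫ y, f y ∂μ) ^ 2 ∂μ ≤ s ^ 2 + ∫ x, f x ^ 2 ∂μ := by
  set m := ∫ y, f y ∂μ with hm
  have h : ∀ x, (s + f x - m) ^ 2 = (s - m) ^ 2 + 2 * (s - m) * f x + f x ^ 2 := fun x => by ring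
  simp_rw [h]
  rw [integral_add (integrable_of_continuous (by fun_prop)) (integrable_of_continuous (by fun_prop)),
    integral_add (integrable_of_continuous (by fun_prop)) (integrable_of_continuous (by fun_prop)),
    integral_const_mul, ← hm]
  simp only [integral_const, probReal_univ, one_smul]
  nlinarith [sq_nonneg m]

variable [TopologicalSpace K] [CompactSpace K] [MeasurableSpace K] [OpensMeasurableSpace K]
  {ν : Measure K} [IsFiniteMeasure ν]

/-- A pair of means over a probability space is approximated in `L²` by the average of `k`
samples, with squared error at most `1 / k` times the second moment. -/
theorem exists_sample {f g : X → K → ℝ} (hf : Continuous f.uncurry) (hg : Continuous g.uncurry)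
    (k : ℕ) : ∃ u : Fin k → X,
      ∫ w, ((∑ j, (f (u j) w - ∫ x, f x w ∂μ)) ^ 2 + (∑ j, (g (u j) w - ∫ x, g x w ∂μ)) ^ 2) ∂ν ≤
        k * ∫ w, ((∫ x, f x w ^ 2 ∂μ) + ∫ x, g x w ^ 2 ∂μ) ∂ν := by
  have hmean : ∀ {h : X → K → ℝ}, Continuous h.uncurry → Continuous fun w => ∫ x, h x w ∂μ :=
    fun {h} hh => continuous_integral_right (f := fun w x => h x w)
      (hh.comp (continuous_swap))
  have hslice : ∀ {h : X → K → ℝ}, Continuous h.uncurry → ∀ x, Continuous (h x) :=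
    fun {h} hh x => hh.comp (Continuous.prodMk_right x)
  have hslice' : ∀ {h : X → K → ℝ}, Continuous h.uncurry → ∀ w, Continuous (fun x => h x w) :=
    fun {h} hh w => hh.comp (Continuous.prodMk_left w)
  induction k with
  | zero => exact ⟨Fin.elim0, by simp⟩
  | succ k ih =>
    obtain ⟨u, hu⟩ := ih
    have hS : ∀ {h : X → K → ℝ}, Continuous h.uncurry →
        Continuous fun w => ∑ j, (h (u j) w - ∫ x, h x w ∂μ) := fun {h} hh =>
      continuous_finsetSum _ fun j _ => (hslice hh _).sub (hmean hh)
    have hstep : ∀ {h : X → K → ℝ}, Continuous h.uncurry → Continuous (Function.uncurry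
        fun x w => (∑ j, (h (u j) w - ∫ x, h x w ∂μ) + h x w - ∫ x, h x w ∂μ) ^ 2) :=
      fun {h} hh => by
        have h1 := (hS hh).comp (continuous_snd (X := X))
        have h2 := (hmean hh).comp (continuous_snd (X := X))
        exact ((h1.add hh).sub h2).pow 2
    have hsq : ∀ {h : X → K → ℝ}, Continuous h.uncurry → Continuous fun w => ∫ x, h x w ^ 2 ∂μ :=
      fun {h} hh => hmean (h := fun x w => h x w ^ 2) (hh.pow 2)
    set E : X → ℝ := fun x => ∫ w,
      ((∑ j, (f (u j) w - ∫ x, f x w ∂μ) + f x w - ∫ x, f x w ∂μ) ^ 2 +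
        (∑ j, (g (u j) w - ∫ x, g x w ∂μ) + g x w - ∫ x, g x w ∂μ) ^ 2) ∂ν with hE
    have hEc : Continuous E := continuous_integral_right ((hstep hf).add (hstep hg))
    obtain ⟨x, hx⟩ := exists_le_integral (μ := μ) (integrable_of_continuous hEc)
    have havg : ∫ x, E x ∂μ ≤
        (∫ w, ((∑ j, (f (u j) w - ∫ x, f x w ∂μ)) ^ 2 +
          (∑ j, (g (u j) w - ∫ x, g x w ∂μ)) ^ 2) ∂ν) +
        ∫ w, ((∫ x, f x w ^ 2 ∂μ) + ∫ x, g x w ^ 2 ∂μ) ∂ν := by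
      rw [hE, integral_swap_of_continuous ((hstep hf).add (hstep hg))]
      refine le_of_le_of_eq ?_
        (integral_add (integrable_of_continuous (((hS hf).pow 2).add ((hS hg).pow 2)))
          (integrable_of_continuous ((hsq hf).add (hsq hg))))
      refine integral_mono ?_ ?_ fun w => ?_
      · refine integrable_of_continuous (continuous_integral_right
          (f := fun w x => (∑ j, (f (u j) w - ∫ x, f x w ∂μ) + f x w - ∫ x, f x w ∂μ) ^ 2 +
            (∑ j, (g (u j) w - ∫ x, g x w ∂μ) + g x w - ∫ x, g x w ∂μ) ^ 2) ?_)
        exact ((hstep hf).add (hstep hg)).comp continuous_swap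
      · exact integrable_of_continuous
          ((((hS hf).pow 2).add ((hS hg).pow 2)).add ((hsq hf).add (hsq hg)))
      · dsimp only
        rw [integral_add
          (integrable_of_continuous (hslice' (hstep hf) w))
          (integrable_of_continuous (hslice' (hstep hg) w))]
        have h1 := integral_sq_add_sub_integral_le (μ := μ) (hslice' hf w)
          (∑ j, (f (u j) w - ∫ x, f x w ∂μ))
        have h2 := integral_sq_add_sub_integral_le (μ := μ) (hslice' hg w)
          (∑ j, (g (u j) w - ∫ x, g x w ∂μ))
        linarith
    refine ⟨Fin.snoc u x, ?_⟩
    simp only [Fin.sum_univ_castSucc, Fin.snoc_castSucc, Fin.snoc_last]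
    have : ∀ a b c : ℝ, a + (b - c) = a + b - c := fun a b c => by ring
    simp only [this]
    push_cast
    rw [add_mul, one_mul]
    linarith

end Sampling

section Intermediate

variable {X : Type*} [TopologicalSpace X] [CompactSpace X] [MeasurableSpace X] [BorelSpace X]
  {μ : Measure X} [μ.OuterRegular] [NullSingletonClass μ]

theorem exists_cover_measure_le {η : ℝ≥0∞} (hη : η ≠ 0) :
    ∃ (s : Finset X) (U : X → Set X), (∀ i, MeasurableSet (U i)) ∧
      (∀ i, μ (U i) ≤ η) ∧ ⋃ i ∈ s, U i = Set.univ := by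
  have h : ∀ x : X, ∃ U : Set X, x ∈ U ∧ IsOpen U ∧ μ U < η := fun x => by
    obtain ⟨U, hU, ho, hm⟩ := Set.exists_isOpen_lt_of_lt ({x} : Set X) η
      ((measure_singleton (μ := μ) x).trans_lt (pos_iff_ne_zero.2 hη))
    exact ⟨U, hU rfl, ho, hm⟩
  choose U hx ho hm using h
  obtain ⟨s, hs⟩ := isCompact_univ.elim_finite_subcover U ho fun x _ => Set.mem_iUnion.2 ⟨x, hx x⟩
  exact ⟨s, U, fun x => (ho x).measurableSet, fun x => (hm x).le, Set.univ_subset_iff.1 hs⟩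

theorem exists_superset_measure_near {A B : Set X} {c η : ℝ≥0∞} (hη : η ≠ 0)
    (hA : MeasurableSet A) (hB : MeasurableSet B) (hBA : B ⊆ A) (hBc : μ B ≤ c) (hcA : c ≤ μ A) :
    ∃ B', B ⊆ B' ∧ B' ⊆ A ∧ MeasurableSet B' ∧ μ B' ≤ c ∧ c ≤ μ B' + η := by
  classical
  obtain ⟨s, U, hUm, hUη, hU⟩ := exists_cover_measure_le (μ := μ) hη
  have key : ∀ s : Finset X, c ≤ μ (B ∪ A ∩ ⋃ i ∈ s, U i) →
      ∃ B', B ⊆ B' ∧ B' ⊆ A ∧ MeasurableSet B' ∧ μ B' ≤ c ∧ c ≤ μ B' + η := by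
    intro s
    induction s using Finset.induction_on with
    | empty =>
      intro h
      exact ⟨B, le_rfl, hBA, hB, hBc, (by simpa using h : c ≤ μ B).trans le_self_add⟩
    | insert a s _ ih =>
      intro h
      by_cases hs : c ≤ μ (B ∪ A ∩ ⋃ i ∈ s, U i)
      · exact ih hs
      · refine ⟨B ∪ A ∩ ⋃ i ∈ s, U i, Set.subset_union_left,
          Set.union_subset hBA Set.inter_subset_left,
          hB.union (hA.inter (Finset.measurableSet_biUnion _ fun i _ => hUm i)),
          (not_le.1 hs).le, h.trans ?_⟩
        refine (measure_mono ?_).trans ((measure_union_le _ (U a)).trans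
          (add_le_add_right (hUη a) _))
        rw [Finset.set_biUnion_insert]
        intro x
        simp only [Set.mem_union, Set.mem_inter_iff]
        tauto
  refine key s ?_
  rwa [hU, Set.inter_univ, Set.union_eq_self_of_subset_left hBA]

/-- Sierpiński's theorem for an atomless outer regular measure on a compact space. -/
theorem exists_subset_measure_eq {A : Set X} {c : ℝ≥0∞} (hA : MeasurableSet A) (hcA : c ≤ μ A) :
    ∃ B, B ⊆ A ∧ MeasurableSet B ∧ μ B = c := by
  let S := {B : Set X // B ⊆ A ∧ MeasurableSet B ∧ μ B ≤ c}
  have h : ∀ (n : ℕ) (B : S), ∃ B' : S, B.1 ⊆ B'.1 ∧ c ≤ μ B'.1 + ((n : ℝ≥0∞) + 1)⁻¹ := by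
    intro n B
    obtain ⟨B', h1, h2, h3, h4, h5⟩ := exists_superset_measure_near (μ := μ)
      (η := ((n : ℝ≥0∞) + 1)⁻¹) (ENNReal.inv_ne_zero.2 (by finiteness)) hA B.2.2.1 B.2.1 B.2.2.2 hcA
    exact ⟨⟨B', h2, h3, h4⟩, h1, h5⟩
  choose step hsub hle using h
  let seq : ℕ → S := fun n => Nat.rec ⟨∅, by simp⟩ (fun n B => step n B) n
  have hmono : Monotone fun n => (seq n).1 := monotone_nat_of_le_succ fun n => hsub n (seq n)
  refine ⟨⋃ n, (seq n).1, Set.iUnion_subset fun n => (seq n).2.1,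
    MeasurableSet.iUnion fun n => (seq n).2.2.1, le_antisymm ?_ ?_⟩
  · rw [hmono.measure_iUnion]
    exact iSup_le fun n => (seq n).2.2.2
  · have h1 : ∀ n : ℕ, c ≤ μ (⋃ n, (seq n).1) + ((n + 1 : ℕ) : ℝ≥0∞)⁻¹ := fun n => by
      refine (hle n (seq n)).trans ?_
      push_cast
      exact add_le_add_left (measure_mono (Set.subset_iUnion (fun n => (seq n).1) (n + 1))) _
    have h2 := (ENNReal.tendsto_inv_nat_nhds_zero.comp (Filter.tendsto_add_atTop_nat 1)).const_add
      (μ (⋃ n, (seq n).1))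
    rw [add_zero] at h2
    exact ge_of_tendsto' h2 h1

theorem exists_disjoint_pieces [IsFiniteMeasure μ] {c : ℝ≥0∞} (n : ℕ) {A : Set X} (hA : MeasurableSet A)
    (h : n * c ≤ μ A) :
    ∃ Y : Fin n → Set X, (∀ i, MeasurableSet (Y i)) ∧ (∀ i, Y i ⊆ A) ∧
      (Pairwise fun i j => Disjoint (Y i) (Y j)) ∧ ∀ i, μ (Y i) = c := by
  induction n generalizing A with
  | zero => exact ⟨Fin.elim0, Fin.rec0, Fin.rec0, fun i => Fin.elim0 i, Fin.rec0⟩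
  | succ n ih =>
    push_cast at h
    rw [add_mul, one_mul] at h
    obtain ⟨B, hBA, hB, hBc⟩ := exists_subset_measure_eq hA (le_add_self.trans h)
    have hc : c ≠ ⊤ := hBc ▸ measure_ne_top μ B
    obtain ⟨Y, hY, hYA, hYd, hYc⟩ := ih (hA.diff hB) (by
      rw [measure_sdiff hBA hB.nullMeasurableSet (measure_ne_top _ _), hBc]
      exact ENNReal.le_sub_of_add_le_right hc h)
    refine ⟨Fin.cons B Y, ?_, ?_, ?_, ?_⟩
    · exact Fin.cases hB hY
    · exact Fin.cases hBA fun i => (hYA i).trans Set.sdiff_subset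
    · have hd : ∀ i, Disjoint B (Y i) := fun i =>
        Set.disjoint_left.2 fun x hx hy => (hYA i hy).2 hx
      intro i j hij
      induction i using Fin.cases with
      | zero =>
        induction j using Fin.cases with
        | zero => exact absurd rfl hij
        | succ j => simpa using hd j
      | succ i =>
        induction j using Fin.cases with
        | zero => simpa using (hd i).symm
        | succ j => simpa using hYd fun h => hij (congrArg _ h)
    · exact Fin.cases hBc hYc

end Intermediate

section Partition

variable {G : Type*} [AddCommGroup G] [TopologicalSpace G] [IsTopologicalAddGroup G]
  [CompactSpace G] [T2Space G] [MeasurableSpace G] [BorelSpace G]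

theorem nullSingletonClass_haarProb [Infinite G] : NullSingletonClass (haarProb G) := by
  have : (nhdsWithin (0 : G) {0}ᶜ).NeBot := by
    by_contra h
    rw [Filter.not_neBot] at h
    have h0 : IsOpen ({0} : Set G) := isOpen_singleton_iff_punctured_nhds 0 |>.2 h
    have : DiscreteTopology G := discreteTopology_of_isOpen_singleton_zero h0
    exact not_finite_iff_infinite.2 ‹Infinite G› (finite_of_compact_of_discrete)
  infer_instance

theorem exists_almostUniform_of_infinite [Infinite G] {r m : ℕ} (hm : 2 ≤ m) {κ : G → Fin r}
    (hκ : Measurable κ) :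
    ∃ (X : Fin m → Set G) (a : Fin m → Fin r) (B : Set G), IsAlmostUniformPartition X ∧
      MeasurableSet B ∧ haarProb G B ≤ r / m ∧ ∀ i, ∀ x ∈ X i, x ∉ B → κ x = a i := by
  classical
  have := nullSingletonClass_haarProb (G := G)
  set μ := haarProb G with hμ
  set A : Fin r → Set G := fun b => κ ⁻¹' {b} with hAdef
  have hA : ∀ b, MeasurableSet (A b) := fun b => hκ (measurableSet_singleton b)
  have hm0 : (0 : ℝ) < m := by positivity
  have hmE : (m : ℝ≥0∞) ≠ 0 := by simp; omega
  set n : Fin r → ℕ := fun b => ⌊(m : ℝ) * μ.real (A b)⌋₊ with hn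
  have hsumA : ∑ b, μ.real (A b) = 1 := by
    rw [← probReal_univ (μ := μ), ← measureReal_biUnion_finset (s := Finset.univ)]
    · congr 1
      ext x; simp [hAdef]
    · intro b _ b' _ hbb'
      exact Set.disjoint_left.2 fun x hx hx' => hbb' (hx.symm.trans hx')
    · exact fun b _ => hA b
  have hnle : ∀ b, (n b : ℝ) ≤ m * μ.real (A b) := fun b => Nat.floor_le (by positivity)
  have hnlt : ∀ b, m * μ.real (A b) ≤ n b + 1 := fun b => (Nat.lt_floor_add_one _).le
  have hN : ∑ b, n b ≤ m := by
    have : ((∑ b, n b : ℕ) : ℝ) ≤ m := by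
      push_cast
      refine (Finset.sum_le_sum fun b _ => hnle b).trans ?_
      rw [← Finset.mul_sum, hsumA, mul_one]
    exact_mod_cast this
  have hN' : m ≤ ∑ b, n b + r := by
    have : (m : ℝ) ≤ ((∑ b, n b + r : ℕ) : ℝ) := by
      push_cast
      calc (m : ℝ) = ∑ b, m * μ.real (A b) := by rw [← Finset.mul_sum, hsumA, mul_one]
        _ ≤ ∑ b, ((n b : ℝ) + 1) := Finset.sum_le_sum fun b _ => hnlt b
        _ = _ := by simp [Finset.sum_add_distrib]
    exact_mod_cast this
  set c : ℝ≥0∞ := (m : ℝ≥0∞)⁻¹ with hc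
  have hmc : (m : ℝ≥0∞) * c = 1 := ENNReal.mul_inv_cancel hmE (by finiteness)
  have hpieces : ∀ b, n b * c ≤ μ (A b) := fun b => by
    have h1 : ((n b : ℝ≥0∞)) ≤ m * μ (A b) := by
      have := ENNReal.ofReal_le_ofReal (hnle b)
      rwa [ENNReal.ofReal_natCast, ENNReal.ofReal_mul hm0.le, ENNReal.ofReal_natCast,
        ofReal_measureReal] at this
    calc n b * c ≤ m * μ (A b) * c := mul_le_mul_left h1 c
      _ = μ (A b) := by rw [mul_right_comm, hmc, one_mul]
  choose Y hYm hYA hYd hYc using fun b => exists_disjoint_pieces (n b) (hA b) (hpieces b)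
  set Y' : (Σ b, Fin (n b)) → Set G := fun p => Y p.1 p.2 with hY'
  have hY'd : Pairwise fun p q => Disjoint (Y' p) (Y' q) := by
    rintro ⟨b, i⟩ ⟨b', i'⟩ hne
    by_cases hb : b = b'
    · subst hb
      exact hYd b fun h => hne (congrArg (Sigma.mk b) h)
    · exact Set.disjoint_left.2 fun x hx hx' => hb ((hYA b i hx).symm.trans (hYA b' i' hx'))
  set B : Set G := (⋃ p, Y' p)ᶜ with hB
  have hY'm : ∀ p, MeasurableSet (Y' p) := fun p => hYm p.1 p.2
  have hBm : MeasurableSet B := (MeasurableSet.iUnion hY'm).compl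
  set q : ℕ := m - ∑ b, n b with hq
  have hμB : μ B = q * c := by
    rw [hB, prob_compl_eq_one_sub (MeasurableSet.iUnion hY'm),
      measure_iUnion hY'd hY'm, tsum_fintype]
    simp only [hY', hYc, Finset.sum_const, Finset.card_univ, Fintype.card_sigma, Fintype.card_fin,
      nsmul_eq_mul]
    refine ENNReal.sub_eq_of_eq_add (by finiteness) ?_
    rw [← hmc, ← add_mul, ← Nat.cast_add, hq, Nat.sub_add_cancel hN]
  obtain ⟨W, hWm, hWB, hWd, hWc⟩ := exists_disjoint_pieces q hBm hμB.ge
  set P : (Σ b, Fin (n b)) ⊕ Fin q → Set G := Sum.elim Y' W with hP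
  have hPd : Pairwise fun s t => Disjoint (P s) (P t) := by
    have hYW : ∀ p j, Disjoint (Y' p) (W j) := fun p j =>
      Set.disjoint_left.2 fun x hx hx' => hWB j hx' (Set.mem_iUnion.2 ⟨p, hx⟩)
    rintro (p | j) (p' | j') hne
    · exact hY'd fun h => hne (by rw [h])
    · exact hYW p j'
    · exact (hYW p' j).symm
    · exact hWd fun h => hne (by rw [h])
  have hPm : ∀ s, MeasurableSet (P s) := by
    rintro (p | j)
    · exact hY'm p
    · exact hWm j
  have hPc : ∀ s, μ (P s) = c := by
    rintro (p | j)
    · exact hYc p.1 p.2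
    · exact hWc j
  have e : Fin m ≃ (Σ b, Fin (n b)) ⊕ Fin q := Fintype.equivOfCardEq (by
    simp only [Fintype.card_fin, Fintype.card_sum, Fintype.card_sigma]
    omega)
  set N : Set G := (⋃ s, P s)ᶜ with hNdef
  have hNm : MeasurableSet N := (MeasurableSet.iUnion hPm).compl
  have hN0 : μ N = 0 := by
    rw [hNdef, prob_compl_eq_zero_iff (MeasurableSet.iUnion hPm),
      measure_iUnion hPd hPm, tsum_fintype]
    simp only [hPc, Finset.sum_const, Finset.card_univ, nsmul_eq_mul]
    rw [← Fintype.card_congr e, Fintype.card_fin, hmc]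
  set i₀ : Fin m := ⟨0, by omega⟩
  set X : Fin m → Set G := fun i => P (e i) ∪ if i = i₀ then N else ∅ with hX
  have hXm : ∀ i, MeasurableSet (X i) := fun i => (hPm _).union (by
    split_ifs
    exacts [hNm, MeasurableSet.empty])
  have hPN : ∀ s, Disjoint (P s) N := fun s =>
    Set.disjoint_left.2 fun x hx hx' => hx' (Set.mem_iUnion.2 ⟨s, hx⟩)
  refine ⟨X, fun i => Sum.elim (fun p => p.1) (fun _ => κ 0) (e i), B, ⟨hm, hXm, ?_, ?_, ?_, ?_⟩,
    hBm, ?_, ?_⟩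
  · intro i j hij
    have h1 : Disjoint (P (e i)) (P (e j)) := hPd fun h => hij (e.injective h)
    simp only [hX]
    split_ifs with h2 h3 h3
    · exact absurd (h2.trans h3.symm) hij
    · simpa [h1] using (hPN _).symm
    · simpa [h1] using hPN _
    · simpa using h1
  · rw [Set.eq_univ_iff_forall]
    intro x
    by_cases hx : x ∈ ⋃ s, P s
    · obtain ⟨s, hs⟩ := Set.mem_iUnion.1 hx
      exact Set.mem_iUnion.2 ⟨e.symm s, Or.inl (by simpa using hs)⟩
    · exact Set.mem_iUnion.2 ⟨i₀, Or.inr (by rw [if_pos rfl]; exact hx)⟩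
  · intro _ i
    rw [one_div]
    refine le_antisymm ?_ ?_
    · refine (measure_union_le _ _).trans ?_
      rw [hPc]
      split_ifs <;> simp [hN0, ← hμ, ← hc]
    · exact (hPc (e i)).ge.trans (measure_mono Set.subset_union_left)
  · intro hfin
    exact absurd hfin (not_finite_iff_infinite.2 ‹_›)
  · rw [hμB, hc, ENNReal.div_eq_inv_mul, mul_comm]
    have : q ≤ r := by omega
    gcongr
  · intro i x hx hxB
    have hx' : x ∈ ⋃ p, Y' p := not_not.1 hxB
    obtain ⟨p, hp⟩ := Set.mem_iUnion.1 hx'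
    have hxN : x ∉ N := fun h => h (Set.mem_iUnion.2 ⟨.inl p, hp⟩)
    have hxP : x ∈ P (e i) := by
      rcases hx with h | h
      · exact h
      · split_ifs at h
        · exact absurd h hxN
        · exact absurd h (Set.notMem_empty x)
    have he : e i = .inl p := by
      by_contra hne
      exact Set.disjoint_left.1 (hPd hne) hxP hp
    dsimp only
    rw [he]
    exact hYA p.1 p.2 hp

end Partition

section FinitePartition

variable {G : Type*} [AddCommGroup G] [TopologicalSpace G] [IsTopologicalAddGroup G]
  [CompactSpace G] [T2Space G] [MeasurableSpace G] [BorelSpace G]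

theorem haarProb_finset [Fintype G] (s : Finset G) :
    haarProb G s = s.card / Fintype.card G := by
  have h : ∀ t : Finset G, haarProb G t = t.card * haarProb G {0} := fun t => by
    rw [← sum_measure_singleton]
    simp only [Measure.addHaar_singleton, Finset.sum_const, nsmul_eq_mul]
  have h1 := h Finset.univ
  rw [Finset.coe_univ, measure_univ, Finset.card_univ] at h1
  rw [h s, div_eq_mul_inv]
  congr 1
  exact ENNReal.eq_inv_of_mul_eq_one_left (by rw [mul_comm]; exact h1.symm)

theorem natFloor_natCast_div (n m : ℕ) : ⌊(n : ℝ) / m⌋₊ = n / m := Nat.floor_div_eq_div n m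

theorem natCeil_of_eq {n m q : ℕ} (hm : 0 < m) (h1 : q * m < n) (h2 : n ≤ (q + 1) * m) :
    ⌈(n : ℝ) / m⌉₊ = q + 1 := by
  have hm' : (0 : ℝ) < m := by exact_mod_cast hm
  rw [Nat.ceil_eq_iff (by omega)]
  rw [lt_div_iff₀ hm', div_le_iff₀ hm']
  simp only [add_tsub_cancel_right]
  exact ⟨by exact_mod_cast h1, by exact_mod_cast h2⟩

theorem exists_almostUniform_of_lt [Fintype G] {r m : ℕ} (hm : 2 ≤ m)
    (hlt : Fintype.card G < m) (κ : G → Fin r) :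
    ∃ (X : Fin m → Set G) (a : Fin m → Fin r) (B : Set G), IsAlmostUniformPartition X ∧
      MeasurableSet B ∧ haarProb G B ≤ r / m ∧ ∀ i, ∀ x ∈ X i, x ∉ B → κ x = a i := by
  classical
  set e := Fintype.equivFin G
  have hpos : 0 < Fintype.card G := Fintype.card_pos
  have huniq : ∀ i : Fin m, {x : G | (e x : ℕ) = i}.Subsingleton := fun i x hx y hy =>
    e.injective (Fin.ext (hx.trans hy.symm))
  refine ⟨fun i => {x | (e x : ℕ) = i},
    fun i => if h : ∃ x, (e x : ℕ) = i then κ h.choose else κ 0, ∅,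
    ⟨hm, fun i => (Set.toFinite _).measurableSet, ?_, ?_, ?_, ?_⟩, MeasurableSet.empty, by simp, ?_⟩
  · intro i j hij
    exact Set.disjoint_left.2 fun x hx hx' => hij (Fin.ext (hx.symm.trans hx'))
  · rw [Set.eq_univ_iff_forall]
    exact fun x => Set.mem_iUnion.2 ⟨⟨e x, (e x).2.trans hlt⟩, rfl⟩
  · intro h
    exact absurd (Finite.of_fintype G) (not_finite_iff_infinite.2 h)
  · intro _ i
    rw [Nat.card_eq_fintype_card, natFloor_natCast_div, Nat.div_eq_of_lt hlt,
      natCeil_of_eq (q := 0) (by omega) (by omega) (by omega)]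
    have := Set.ncard_le_one_iff_subsingleton.2 (huniq i)
    omega
  · intro i x hx _
    have h : ∃ x, (e x : ℕ) = i := ⟨x, hx⟩
    dsimp only
    rw [dif_pos h, huniq i hx h.choose_spec]

theorem exists_almostUniform_of_le [Fintype G] {r m : ℕ} (hm : 2 ≤ m)
    (hle : m ≤ Fintype.card G) (κ : G → Fin r) :
    ∃ (X : Fin m → Set G) (a : Fin m → Fin r) (B : Set G), IsAlmostUniformPartition X ∧
      MeasurableSet B ∧ haarProb G B ≤ r / m ∧ ∀ i, ∀ x ∈ X i, x ∉ B → κ x = a i := by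
  classical
  set n := Fintype.card G with hn
  set q := n / m with hq
  have hq0 : q ≠ 0 := (Nat.div_pos hle (by omega)).ne'
  have hmod : n % m < m := Nat.mod_lt _ (by omega)
  have hdm : m * q + n % m = n := Nat.div_add_mod n m
  have hab : (m - n % m) * q + (n % m) * (q + 1) = (Finset.univ : Finset G).card := by
    rw [Finset.card_univ, ← hn, Nat.sub_mul, Nat.mul_add, ← Nat.add_assoc,
      Nat.sub_add_cancel (Nat.mul_le_mul_right q hmod.le), mul_one, hdm]
  set P : Finpartition (Finset.univ : Finset G) := Finpartition.ofSetoid (Setoid.ker κ) with hP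
  have hPκ : ∀ x y, y ∈ P.part x ↔ κ x = κ y := fun x y =>
    Finpartition.mem_part_ofSetoid_iff_rel (s := Setoid.ker κ)
  have hPcard : P.parts.card ≤ r := by
    have : P.parts.card ≤ (Finset.univ : Finset (Fin r)).card := by
      refine Finset.card_le_card_of_surjOn (fun b => Finset.univ.filter fun x => κ x = b) ?_
      intro t ht
      obtain ⟨x, hx⟩ := P.nonempty_of_mem_parts ht
      refine ⟨κ x, by simp, ?_⟩
      ext y
      rw [← P.part_eq_of_mem ht hx, hPκ]
      simp [eq_comm]
    simpa using this
  set Q := P.equitabilise hab with hQ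
  have hQcard : Q.parts.card = m := by
    rw [hQ, Finpartition.card_parts_equitabilise _ _ hq0, Nat.sub_add_cancel hmod.le]
  set e : Fin m ≃ Q.parts := (Q.parts.equivFinOfCardEq hQcard).symm
  set B : Finset G := P.parts.biUnion fun t => t \ (Q.parts.filter fun u => u ⊆ t).biUnion id
    with hB
  have hBcard : B.card ≤ r * q := by
    refine (Finset.card_biUnion_le_card_mul _ _ q fun t ht =>
      Finpartition.card_parts_equitabilise_subset_le P hab ht).trans ?_
    exact Nat.mul_le_mul_right q hPcard
  refine ⟨fun i => ((e i).1 : Set G),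
    fun i => if h : (e i).1.Nonempty then κ h.choose else κ 0, B,
    ⟨hm, fun i => (Set.toFinite _).measurableSet, ?_, ?_, ?_, ?_⟩,
    (Set.toFinite _).measurableSet, ?_, ?_⟩
  · intro i j hij
    rw [Finset.disjoint_coe]
    exact Q.disjoint (e i).2 (e j).2 fun h => hij (e.injective (Subtype.ext h))
  · rw [Set.eq_univ_iff_forall]
    intro x
    obtain ⟨u, hu, hx⟩ := Q.exists_mem (Finset.mem_univ x)
    exact Set.mem_iUnion.2 ⟨e.symm ⟨u, hu⟩, by simpa using hx⟩
  · intro h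
    exact absurd (Finite.of_fintype G) (not_finite_iff_infinite.2 h)
  · intro _ i
    rw [Nat.card_eq_fintype_card, natFloor_natCast_div, Set.ncard_coe_finset]
    rcases Finpartition.card_eq_of_mem_parts_equitabilise (e i).2 with h | h
    · exact Or.inl h
    · right
      have hmod0 : 0 < n % m := by
        have h1 := Finpartition.card_filter_equitabilise_big P hab
        rw [← h1]
        exact Finset.card_pos.2 ⟨(e i).1, Finset.mem_filter.2 ⟨(e i).2, h⟩⟩
      rw [h, natCeil_of_eq (q := q) (by omega)]
      · rw [← hn, mul_comm]; omega
      · rw [← hn, add_mul, mul_comm]; omega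
  · rw [haarProb_finset, ← hn]
    have hm0 : (m : ℝ≥0∞) ≠ 0 := by simp; omega
    have hn0 : (n : ℝ≥0∞) ≠ 0 := by simp; omega
    rw [ENNReal.div_le_iff hn0 (by finiteness), ENNReal.div_eq_inv_mul, mul_assoc,
      ← ENNReal.div_eq_inv_mul, ENNReal.le_div_iff_mul_le (Or.inl hm0) (Or.inl (by finiteness))]
    have : B.card * m ≤ r * n := by
      calc B.card * m ≤ r * q * m := Nat.mul_le_mul_right m hBcard
        _ = r * (m * q) := by ring
        _ ≤ r * n := Nat.mul_le_mul_left r (by omega)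
    exact_mod_cast this
  · intro i x hx hxB
    have hxB : x ∉ B := hxB
    have hne : (e i).1.Nonempty := ⟨x, hx⟩
    dsimp only
    rw [dif_pos hne]
    have hxt : x ∈ P.part x := P.mem_part (Finset.mem_univ x)
    have hx' : x ∈ (Q.parts.filter fun u => u ⊆ P.part x).biUnion id := by
      by_contra hcon
      exact hxB (Finset.mem_biUnion.2 ⟨P.part x, P.part_mem.2 (Finset.mem_univ x),
        Finset.mem_sdiff.2 ⟨hxt, hcon⟩⟩)
    obtain ⟨u, hu, hxu⟩ := Finset.mem_biUnion.1 hx'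
    rw [Finset.mem_filter] at hu
    have huX : (e i).1 = u := Q.eq_of_mem_parts (e i).2 hu.1 hx hxu
    have h1 := hne.choose_spec
    exact (hPκ x _).1 (hu.2 (huX ▸ h1))

end FinitePartition

/-- Any finite measurable colouring of a compact abelian group is constant, up to a small set, on
the classes of an almost uniform partition. -/
theorem exists_almostUniform {G : Type*} [AddCommGroup G] [TopologicalSpace G]
    [IsTopologicalAddGroup G] [CompactSpace G] [T2Space G] [MeasurableSpace G] [BorelSpace G]
    {r m : ℕ} (hm : 2 ≤ m) {κ : G → Fin r} (hκ : Measurable κ) :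
    ∃ (X : Fin m → Set G) (a : Fin m → Fin r) (B : Set G), IsAlmostUniformPartition X ∧
      MeasurableSet B ∧ haarProb G B ≤ r / m ∧ ∀ i, ∀ x ∈ X i, x ∉ B → κ x = a i := by
  cases finite_or_infinite G
  · have := Fintype.ofFinite G
    rcases lt_or_ge (Fintype.card G) m with h | h
    · exact exists_almostUniform_of_lt hm h κ
    · exact exists_almostUniform_of_le hm h κ
  · exact exists_almostUniform_of_infinite hm hκ

section FourierAlgebra

variable {G : Type*} [AddCommGroup G] [TopologicalSpace G] [IsTopologicalAddGroup G]
  [CompactSpace G] [MeasurableSpace G] [BorelSpace G] {d : ℕ}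

open Classical in
theorem normProd_update_mul (f : PuncturedCube d → G → ℝ) (a : PuncturedCube d) (r : ℝ) :
    normProd d (Function.update f a fun y => r * f a y) = |r| * normProd d f := by
  rw [normProd, normProd, ← Finset.mul_prod_erase _ _ (Finset.mem_univ a),
    ← Finset.mul_prod_erase Finset.univ (fun ε => (eLpNorm (f ε) _ _).toReal) (Finset.mem_univ a),
    Function.update_self, ← mul_assoc]
  congr 1
  · have : eLpNorm (fun y => r * f a y) (2 ^ (d - 1)) (haarProb G) =
        ‖r‖ₑ * eLpNorm (f a) (2 ^ (d - 1)) (haarProb G) := eLpNorm_const_smul r (f a) _ _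
    rw [this, ENNReal.toReal_mul, toReal_enorm, Real.norm_eq_abs]
  · exact Finset.prod_congr rfl fun ε hε => by
      rw [Function.update_of_ne (Finset.ne_of_mem_erase hε)]

/-- Finite linear combinations of cubic convolution products belong to the Fourier algebra. -/
theorem memFourierAlgebra_sum (hd : 1 ≤ d) {k : ℕ} {g : Fin k → PuncturedCube d → G → ℝ}
    (hg : ∀ j ε, MemLp (g j ε) (2 ^ (d - 1)) (haarProb G))
    (hg1 : ∀ j ε, eLpNorm (g j ε) (2 ^ (d - 1)) (haarProb G) ≤ 1) (w : Fin k → ℝ) :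
    MemFourierAlgebra d (fun x => ∑ j, w j * cubicProd d (g j) x) ∧
      fourierAlgebraNorm d (fun x => ∑ j, w j * cubicProd d (g j) x) ≤ ∑ j, |w j| := by
  classical
  have a : PuncturedCube d := ⟨fun _ => 1, fun h => by simpa using congrFun h ⟨0, hd⟩⟩
  set F : ℕ → PuncturedCube d → G → ℝ := fun j =>
    if h : j < k then Function.update (g ⟨j, h⟩) a fun y => w ⟨j, h⟩ * g ⟨j, h⟩ a y
    else fun _ _ => 0 with hF
  have hFlt : ∀ j : Fin k, F j = Function.update (g j) a fun y => w j * g j a y := fun j => by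
    simp [hF]
  have hFge : ∀ j ∉ Finset.range k, F j = fun _ _ => 0 := fun j hj => by
    simp only [Finset.mem_range] at hj
    simp [hF, hj]
  have hN0 : ∀ j ∉ Finset.range k, normProd d (F j) = 0 := fun j hj => by
    rw [hFge j hj, normProd]
    exact Finset.prod_eq_zero (Finset.mem_univ a) (by simp)
  have hsum : HasSum (fun j => normProd d (F j)) (∑ j : Fin k, |w j| * normProd d (g j)) := by
    have : HasSum (fun j => normProd d (F j)) _ := hasSum_sum_of_ne_finset_zero hN0
    rw [Finset.sum_range] at this
    simpa only [hFlt, normProd_update_mul] using this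
  have hR : Represents d F fun x => ∑ j, w j * cubicProd d (g j) x := by
    refine ⟨fun j ε => ?_, hsum.summable, fun x => ?_⟩
    · by_cases h : j < k
      · rw [show F j = _ from hFlt ⟨j, h⟩]
        exact memLp_update (hg _) ((hg _ a).const_mul _) a ε
      · rw [hFge j (by simpa using h)]
        exact MemLp.zero'
    · have h0 : ∀ j ∉ Finset.range k, cubicProd d (F j) x = 0 := fun j hj => by
        rw [hFge j hj, cubicProd_eq]
        simp [Finset.prod_eq_zero (Finset.mem_univ a)]
      have : HasSum (fun j => cubicProd d (F j) x) _ := hasSum_sum_of_ne_finset_zero h0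
      rw [Finset.sum_range] at this
      simpa only [hFlt, cubicProd_update_mul] using this
  have hbdd : BddBelow {c : ℝ | ∃ F, Represents d F (fun x => ∑ j, w j * cubicProd d (g j) x) ∧
      c = ∑' j, normProd d (F j)} := by
    refine ⟨0, ?_⟩
    rintro _ ⟨F, -, rfl⟩
    exact tsum_nonneg fun j => normProd_nonneg d _
  refine ⟨⟨F, hR⟩, (csInf_le hbdd ⟨F, hR, rfl⟩).trans ?_⟩
  · rw [hsum.tsum_eq]
    exact Finset.sum_le_sum fun j _ => mul_le_of_le_one_right (abs_nonneg _)
      (normProd_le_one (hg1 j))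

/-- Density of continuous functions in the unit ball of `L^p`. -/
theorem exists_continuous_eLpNorm_le_one [T2Space G] {f : G → ℝ} {p : ℝ≥0∞}
    (hf : MemLp f p (haarProb G)) (hp : p ≠ ⊤) (hp1 : 1 ≤ p)
    (hf1 : eLpNorm f p (haarProb G) ≤ 1) {η : ℝ} (hη : 0 < η) :
    ∃ c : G → ℝ, Continuous c ∧ eLpNorm c p (haarProb G) ≤ 1 ∧
      eLpNorm (fun x => f x - c x) p (haarProb G) ≤ ENNReal.ofReal (2 * η) := by
  obtain ⟨c, hc, hfc⟩ := exists_continuous_eLpNorm_sub_le hf hp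
    (η := ENNReal.ofReal η) (by simpa using hη)
  have hcm := memLp_of_continuous hc p
  have hcn : eLpNorm c p (haarProb G) ≤ ENNReal.ofReal (1 + η) := by
    have := eLpNorm_sub_le hf.1 (hf.1.sub hcm.1) hp1
    rw [sub_sub_cancel] at this
    refine this.trans ?_
    rw [ENNReal.ofReal_add zero_le_one hη.le, ENNReal.ofReal_one]
    exact add_le_add hf1 hfc
  have hscale : ∀ r : ℝ, eLpNorm (fun x => r * c x) p (haarProb G) ≤
      ENNReal.ofReal (|r| * (1 + η)) := fun r => by
    have h : eLpNorm (fun x => r * c x) p (haarProb G) =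
        ‖r‖ₑ * eLpNorm c p (haarProb G) := eLpNorm_const_smul r c _ _
    rw [h, ENNReal.ofReal_mul (abs_nonneg _), ← Real.norm_eq_abs, ofReal_norm]
    exact mul_le_mul_right hcn _
  refine ⟨fun x => (1 + η)⁻¹ * c x, by fun_prop, ?_, ?_⟩
  · refine (hscale _).trans ?_
    rw [abs_of_pos (by positivity), inv_mul_cancel₀ (by positivity), ENNReal.ofReal_one]
  · have h1 : (fun x => f x - (1 + η)⁻¹ * c x) =
        (fun x => f x - c x) + fun x => (η * (1 + η)⁻¹) * c x := by
      funext x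
      simp only [Pi.add_apply]
      field_simp
      ring
    rw [h1]
    refine (eLpNorm_add_le (hf.1.sub hcm.1) (hcm.1.const_mul _) hp1).trans ?_
    rw [two_mul, ENNReal.ofReal_add hη.le hη.le]
    refine add_le_add hfc ((hscale _).trans (ENNReal.ofReal_le_ofReal ?_))
    rw [abs_of_pos (by positivity), mul_assoc, inv_mul_cancel₀ (by positivity), mul_one]

end FourierAlgebra

section Approximation

variable {G : Type*} [AddCommGroup G] [TopologicalSpace G] [IsTopologicalAddGroup G]
  {d : ℕ}

/-- The integrand `f_{(1,0)}(x + u) ∏_{η ≠ 0} f_{(1,η)}(x + u + η · s)` of the upper face. -/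
def upperFace (f : PuncturedCube (d + 1) → G → ℝ) (u x : G) (s : CubePow G d) : ℝ :=
  f (high 0) (x + u) * ∏ η : PuncturedCube d, f (high η.1) (x + u + CubePow.dot η.1 s)

/-- The factors of the fibre at `u` of the translate by `t`. -/
def fibre (f : PuncturedCube (d + 1) → G → ℝ) (t u : G) (η : PuncturedCube d) (y : G) : ℝ :=
  f η.low (y + t) * f (high η.1) (y + u)

theorem continuous_fibre {f : PuncturedCube (d + 1) → G → ℝ} (hf : ∀ ε, Continuous (f ε))
    (t u : G) (η : PuncturedCube d) : Continuous (fibre f t u η) := by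
  have h1 := hf η.low
  have h2 := hf (high η.1)
  unfold fibre
  fun_prop

theorem continuous_upperFace {f : PuncturedCube (d + 1) → G → ℝ} (hf : ∀ ε, Continuous (f ε))
    {T : Type*} [TopologicalSpace T] {u x : T → G} {s : T → CubePow G d} (hu : Continuous u)
    (hx : Continuous x) (hs : Continuous s) :
    Continuous fun τ => upperFace f (u τ) (x τ) (s τ) := by
  unfold upperFace
  refine Continuous.mul ((hf _).comp (by fun_prop)) (continuous_finsetProd _ fun η _ => ?_)
  have := CubePow.continuous_dot (G := G) η.1
  exact (hf _).comp (by fun_prop)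

variable [CompactSpace G] [MeasurableSpace G] [BorelSpace G]

theorem eLpNorm_sq_le_one (hd : 1 ≤ d) {f : G → ℝ} (hf : Continuous f)
    (hf1 : eLpNorm f (2 ^ d) (haarProb G) ≤ 1) :
    eLpNorm (fun x => f x * f x) (2 ^ (d - 1)) (haarProb G) ≤ 1 := by
  have hm := (memLp_of_continuous hf 1).1
  have h := eLpNorm_mul_le_two_pow hm hm (d - 1)
  rw [Nat.sub_add_cancel hd] at h
  exact h.trans (mul_le_one' hf1 hf1)

theorem eLpNorm_fibre_le_one (hd : 1 ≤ d) {f : PuncturedCube (d + 1) → G → ℝ}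
    (hf : ∀ ε, Continuous (f ε)) (hf1 : ∀ ε, eLpNorm (f ε) (2 ^ d) (haarProb G) ≤ 1) (t u : G)
    (η : PuncturedCube d) : eLpNorm (fibre f t u η) (2 ^ (d - 1)) (haarProb G) ≤ 1 := by
  have hm : ∀ ε v, AEStronglyMeasurable (fun y => f ε (y + v)) (haarProb G) := fun ε v =>
    (memLp_of_continuous ((hf ε).comp (continuous_add_const v)) 1).1
  have h := eLpNorm_mul_le_two_pow (hm η.low t) (hm (high η.1) u) (d - 1)
  rw [Nat.sub_add_cancel hd, eLpNorm_translate (memLp_of_continuous (hf _) 1).1,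
    eLpNorm_translate (memLp_of_continuous (hf _) 1).1] at h
  exact h.trans (mul_le_one' (hf1 _) (hf1 _))

theorem integral_sq_le_one (hd : 1 ≤ d) {f : G → ℝ} (hf : Continuous f)
    (hf1 : eLpNorm f (2 ^ d) (haarProb G) ≤ 1) : ∫ x, f x ^ 2 ∂haarProb G ≤ 1 := by
  have hsq : Continuous fun x => f x * f x := hf.mul hf
  have h := (integral_abs_le_eLpNorm hsq (d - 1)).trans
    (ENNReal.toReal_mono ENNReal.one_ne_top (eLpNorm_sq_le_one hd hf hf1))
  simpa [abs_mul_abs_self, pow_two] using h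

theorem integral_abs_le_one {f : G → ℝ} (hf : Continuous f)
    (hf1 : eLpNorm f (2 ^ d) (haarProb G) ≤ 1) : ∫ x, |f x| ∂haarProb G ≤ 1 :=
  (integral_abs_le_eLpNorm hf d).trans (by simpa using ENNReal.toReal_mono ENNReal.one_ne_top hf1)

theorem integral_prod_sq_le_one (hd : 1 ≤ d) {f : PuncturedCube d → G → ℝ}
    (hf : ∀ η, Continuous (f η)) (hf1 : ∀ η, eLpNorm (f η) (2 ^ d) (haarProb G) ≤ 1) (x : G) :
    ∫ s : CubePow G d, (∏ η, f η (x + CubePow.dot η.1 s)) ^ 2 ∂haarProb (CubePow G d) ≤ 1 := by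
  have h := (abs_cubicProd_le_of_continuous hd (f := fun η y => f η y * f η y)
    (fun η => (hf η).mul (hf η)) x).trans
      (normProd_le_one fun η => eLpNorm_sq_le_one hd (hf η) (hf1 η))
  refine le_trans (le_of_eq ?_) ((le_abs_self _).trans h)
  rw [cubicProd_eq]
  refine integral_congr_ae (.of_forall fun s => ?_)
  dsimp only
  rw [pow_two, Finset.prod_mul_distrib]

theorem abs_integral_mul_le {X : Type*} [TopologicalSpace X] [CompactSpace X] [MeasurableSpace X]
    [OpensMeasurableSpace X] {μ : Measure X} [IsFiniteMeasure μ] {a b : X → ℝ} (ha : Continuous a)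
    (hb : Continuous b) (ha1 : ∫ x, a x ^ 2 ∂μ ≤ 1) :
    |∫ x, a x * b x ∂μ| ≤ √(∫ x, b x ^ 2 ∂μ) := by
  refine Real.abs_le_sqrt ?_
  set I := ∫ x, a x * b x ∂μ with hI
  have h0 : 0 ≤ ∫ x, (b x - I * a x) ^ 2 ∂μ := integral_nonneg fun x => sq_nonneg _
  have h1 : ∀ x, (b x - I * a x) ^ 2 = b x ^ 2 - 2 * I * (a x * b x) + I ^ 2 * a x ^ 2 :=
    fun x => by ring
  simp_rw [h1] at h0
  rw [integral_add (integrable_of_continuous (by fun_prop)) (integrable_of_continuous (by fun_prop)),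
    integral_sub (integrable_of_continuous (by fun_prop)) (integrable_of_continuous (by fun_prop)),
    integral_const_mul, integral_const_mul, ← hI] at h0
  nlinarith [sq_nonneg I]

/-- The mean square over `s` of the sampling error of the upper face. -/
noncomputable def sampleError (f : PuncturedCube (d + 1) → G → ℝ) {k : ℕ} (u : Fin k → G) (x : G) :
    ℝ :=
  ∫ s : CubePow G d, (∑ j, (upperFace f (u j) x s - ∫ v, upperFace f v x s ∂haarProb G)) ^ 2
    ∂haarProb (CubePow G d)

theorem continuous_sampleError {f : PuncturedCube (d + 1) → G → ℝ} (hf : ∀ ε, Continuous (f ε))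
    {k : ℕ} (u : Fin k → G) : Continuous (sampleError f u) := by
  unfold sampleError
  refine continuous_integral_right (f := fun x s =>
    (∑ j, (upperFace f (u j) x s - ∫ v, upperFace f v x s ∂haarProb G)) ^ 2) ?_
  refine Continuous.pow (continuous_finsetSum _ fun j _ => Continuous.sub ?_ ?_) 2
  · exact continuous_upperFace hf continuous_const continuous_fst continuous_snd
  · exact continuous_integral_right (f := fun (p : G × CubePow G d) v => upperFace f v p.1 p.2)
      (continuous_upperFace hf (by fun_prop) (by fun_prop) (by fun_prop))

/-- The translates of a cubic convolution product are close to averages of finitely many weighted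
fibres, with an error independent of the translation. -/
theorem abs_cubicProd_sub_sum_le (hd : 1 ≤ d) {f : PuncturedCube (d + 1) → G → ℝ}
    (hf : ∀ ε, Continuous (f ε)) (hf1 : ∀ ε, eLpNorm (f ε) (2 ^ d) (haarProb G) ≤ 1) {k : ℕ}
    (u : Fin k → G) (x t : G) :
    |∑ j, f (high 0) (x + u j) * cubicProd d (fibre f t (u j)) x - k * cubicProd (d + 1) f (x + t)|
      ≤ √(sampleError f u x) := by
  set F : CubePow G d → ℝ := fun s => ∏ η : PuncturedCube d, f η.low (x + t + CubePow.dot η.1 s)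
    with hFdef
  have hFc : Continuous F := by
    refine continuous_finsetProd _ fun η _ => (hf _).comp ?_
    have := CubePow.continuous_dot (G := G) η.1
    fun_prop
  have hface : Continuous (Function.uncurry fun (v : G) (s : CubePow G d) => upperFace f v x s) :=
    continuous_upperFace hf continuous_fst continuous_const continuous_snd
  have hfib : ∀ v, f (high 0) (x + v) * cubicProd d (fibre f t v) x =
      ∫ s, F s * upperFace f v x s ∂haarProb (CubePow G d) := by
    intro v
    rw [cubicProd_eq, ← integral_const_mul]
    refine integral_congr_ae (.of_forall fun s => ?_)
    dsimp only [fibre, upperFace, hFdef]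
    rw [mul_left_comm, ← Finset.prod_mul_distrib]
    congr 1
    refine Finset.prod_congr rfl fun η _ => ?_
    rw [add_right_comm x _ t, add_right_comm x _ v]
  have hφ : cubicProd (d + 1) f (x + t) =
      ∫ s, F s * ∫ v, upperFace f v x s ∂haarProb G ∂haarProb (CubePow G d) := by
    rw [cubicProd_succ hf]
    change ∫ v, f (high 0) (x + v) * cubicProd d (fibre f t v) x ∂haarProb G = _
    simp_rw [hfib]
    rw [integral_swap_of_continuous ((hFc.comp continuous_snd).mul hface)]
    simp_rw [integral_const_mul]
  have hm : Continuous fun s => ∫ v, upperFace f v x s ∂haarProb G :=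
    continuous_integral_right (f := fun (s : CubePow G d) v => upperFace f v x s)
      (continuous_upperFace hf (by fun_prop) (by fun_prop) (by fun_prop))
  have hj : ∀ j, Continuous fun s : CubePow G d => upperFace f (u j) x s := fun j =>
    continuous_upperFace hf (by fun_prop) (by fun_prop) (by fun_prop)
  have hS : Continuous fun s : CubePow G d =>
      ∑ j, (upperFace f (u j) x s - ∫ v, upperFace f v x s ∂haarProb G) :=
    continuous_finsetSum _ fun j _ => (hj j).sub hm
  have key : ∑ j, f (high 0) (x + u j) * cubicProd d (fibre f t (u j)) x -
      k * cubicProd (d + 1) f (x + t) =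
      ∫ s, F s * ∑ j, (upperFace f (u j) x s - ∫ v, upperFace f v x s ∂haarProb G)
        ∂haarProb (CubePow G d) := by
    simp_rw [Finset.mul_sum, mul_sub]
    have hsub : ∀ j, ∫ s, (F s * upperFace f (u j) x s -
        F s * ∫ v, upperFace f v x s ∂haarProb G) ∂haarProb (CubePow G d) =
        (∫ s, F s * upperFace f (u j) x s ∂haarProb (CubePow G d)) -
          ∫ s, F s * ∫ v, upperFace f v x s ∂haarProb G ∂haarProb (CubePow G d) := fun j =>
      integral_sub (integrable_of_continuous (hFc.mul (hj j)))
        (integrable_of_continuous (hFc.mul hm))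
    have hint : ∀ j ∈ Finset.univ, Integrable (fun s => F s * upperFace f (u j) x s -
        F s * ∫ v, upperFace f v x s ∂haarProb G) (haarProb (CubePow G d)) := fun j _ =>
      integrable_of_continuous ((hFc.mul (hj j)).sub (hFc.mul hm))
    rw [integral_finsetSum _ hint]
    simp_rw [hsub]
    rw [Finset.sum_sub_distrib, ← hφ]
    simp [hfib]
  rw [key]
  exact abs_integral_mul_le hFc hS
    (integral_prod_sq_le_one hd (fun η => hf η.low) (fun η => hf1 η.low) (x + t))

end Approximation

theorem exists_finite_net (k : ℕ) {R : ℝ} (hR : 0 ≤ R) {ε : ℝ} (hε : 0 < ε) :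
    ∃ (N : ℕ) (S : ℕ → Fin k → ℝ), (∀ n, ∑ j, |S n j| ≤ R) ∧
      ∀ v : Fin k → ℝ, ∑ j, |v j| ≤ R → ∃ n ≤ N, dist (S n) v < ε := by
  set K : Set (Fin k → ℝ) := {v | ∑ j, |v j| ≤ R} with hK
  have hKc : IsCompact K := by
    refine Metric.isCompact_of_isClosed_isBounded
      (isClosed_le (by fun_prop) continuous_const) ?_
    refine (Metric.isBounded_closedBall (x := (0 : Fin k → ℝ)) (r := R)).subset fun v hv => ?_
    rw [mem_closedBall_zero_iff, pi_norm_le_iff_of_nonneg hR]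
    exact fun j => (Finset.single_le_sum (f := fun j => |v j|) (fun _ _ => abs_nonneg _)
      (Finset.mem_univ j)).trans hv
  obtain ⟨t, htK, htf, ht⟩ := hKc.finite_cover_balls hε
  have h0 : (0 : Fin k → ℝ) ∈ K := by simpa [hK] using hR
  have htne : t.Nonempty := by
    obtain ⟨x, hx, -⟩ := Set.mem_iUnion₂.1 (ht h0)
    exact ⟨x, hx⟩
  obtain ⟨S, hS⟩ := htf.countable.exists_eq_range htne
  have hidx : ∀ x : Fin k → ℝ, ∃ n, x ∈ t → S n = x := fun x => by
    by_cases hx : x ∈ t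
    · obtain ⟨n, hn⟩ := hS ▸ hx
      exact ⟨n, fun _ => hn⟩
    · exact ⟨0, fun h => absurd h hx⟩
  choose idx hidx using hidx
  refine ⟨htf.toFinset.sup idx, S, fun n => htK (hS ▸ Set.mem_range_self n), fun v hv => ?_⟩
  obtain ⟨x, hx, hvx⟩ := Set.mem_iUnion₂.1 (ht hv)
  refine ⟨idx x, Finset.le_sup (f := idx) (htf.mem_toFinset.2 hx), ?_⟩
  rw [hidx x hx, dist_comm]
  exact hvx

section Main

variable {G : Type*} [AddCommGroup G] [TopologicalSpace G] [IsTopologicalAddGroup G]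
  [CompactSpace G] [MeasurableSpace G] [BorelSpace G] {d : ℕ}

theorem exists_sample_upperFace (hd : 1 ≤ d) {f : PuncturedCube (d + 1) → G → ℝ}
    (hf : ∀ ε, Continuous (f ε)) (hf1 : ∀ ε, eLpNorm (f ε) (2 ^ d) (haarProb G) ≤ 1) (k : ℕ) :
    ∃ u : Fin k → G, ∫ x, (sampleError f u x +
      (∑ j, (|f (high 0) (x + u j)| - ∫ v, |f (high 0) v| ∂haarProb G)) ^ 2) ∂haarProb G ≤
        2 * k := by
  set hh := f (high 0) with hhdef
  have hhc : Continuous hh := hf _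
  set hdm : CubePow G (d + 1) → G := fun w => w 0 with hhd
  set tl : CubePow G (d + 1) → CubePow G d := fun w => Fin.tail w with htl
  have hhdc : Continuous hdm := continuous_apply (A := fun _ : Fin (d + 1) => G) 0
  have htlc : Continuous tl :=
    continuous_pi fun i => continuous_apply (A := fun _ : Fin (d + 1) => G) i.succ
  have hF : Continuous (Function.uncurry fun (v : G) (w : CubePow G (d + 1)) =>
      upperFace f v (hdm w) (tl w)) :=
    continuous_upperFace hf (by fun_prop) (by fun_prop) (by fun_prop)
  have hg : Continuous (Function.uncurry fun (v : G) (w : CubePow G (d + 1)) =>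
      |hh (hdm w + v)|) := by
    simp only [Function.uncurry_def]; fun_prop
  obtain ⟨u, hu⟩ := exists_sample (μ := haarProb G) (ν := haarProb (CubePow G (d + 1))) hF hg k
  have hmeanF : Continuous fun w : CubePow G (d + 1) =>
      ∫ v, upperFace f v (hdm w) (tl w) ∂haarProb G :=
    continuous_integral_right (f := fun (w : CubePow G (d + 1)) v => upperFace f v (hdm w) (tl w))
      (continuous_upperFace hf (by fun_prop) (by fun_prop) (by fun_prop))
  have htrans : ∀ x, ∫ v, |hh (x + v)| ∂haarProb G = ∫ v, |hh v| ∂haarProb G := fun x =>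
    integral_add_left_eq_self (fun v => |hh v|) x
  have htrans2 : ∀ x, ∫ v, hh (x + v) ^ 2 ∂haarProb G = ∫ v, hh v ^ 2 ∂haarProb G := fun x =>
    integral_add_left_eq_self (fun v => hh v ^ 2) x
  simp only [htrans, sq_abs, htrans2] at hu
  refine ⟨u, ?_⟩
  have hlhs : ∫ w, ((∑ j, (upperFace f (u j) (hdm w) (tl w) -
      ∫ v, upperFace f v (hdm w) (tl w) ∂haarProb G)) ^ 2 +
      (∑ j, (|hh (hdm w + u j)| - ∫ v, |hh v| ∂haarProb G)) ^ 2) ∂haarProb (CubePow G (d + 1)) =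
      ∫ x, (sampleError f u x + (∑ j, (|hh (x + u j)| - ∫ v, |hh v| ∂haarProb G)) ^ 2)
        ∂haarProb G := by
    rw [integral_haarProb_of_surjective CubePow.cons CubePow.continuous_cons
      CubePow.surjective_cons]
    · refine integral_congr_ae (.of_forall fun x => ?_)
      have hS : Continuous fun s : CubePow G d => (∑ j, (upperFace f (u j) x s -
          ∫ v, upperFace f v x s ∂haarProb G)) ^ 2 := by
        refine (continuous_finsetSum _ fun j _ => ?_).pow 2
        refine (continuous_upperFace hf (by fun_prop) (by fun_prop) (by fun_prop)).sub ?_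
        exact continuous_integral_right (f := fun (s : CubePow G d) v => upperFace f v x s)
          (continuous_upperFace hf (by fun_prop) (by fun_prop) (by fun_prop))
      refine (integral_add (μ := haarProb (CubePow G d)) (integrable_of_continuous hS)
        (integrable_const ((∑ j, (|hh (x + u j)| - ∫ v, |hh v| ∂haarProb G)) ^ 2))).trans ?_
      simp only [integral_const, probReal_univ, one_smul]
      rfl
    · refine Continuous.add ((continuous_finsetSum _ fun j _ => ?_).pow 2) (by fun_prop)
      exact (continuous_upperFace hf (by fun_prop) (by fun_prop) (by fun_prop)).sub hmeanF
  have hrhs : ∫ w, ((∫ v, upperFace f v (hdm w) (tl w) ^ 2 ∂haarProb G) +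
      ∫ v, hh v ^ 2 ∂haarProb G) ∂haarProb (CubePow G (d + 1)) ≤ 2 := by
    have hsqc : Continuous fun w : CubePow G (d + 1) =>
        ∫ v, upperFace f v (hdm w) (tl w) ^ 2 ∂haarProb G :=
      continuous_integral_right
        (f := fun (w : CubePow G (d + 1)) v => upperFace f v (hdm w) (tl w) ^ 2)
        ((continuous_upperFace hf (by fun_prop) (by fun_prop) (by fun_prop)).pow 2)
    rw [integral_add (integrable_of_continuous hsqc) (integrable_const _),
      integral_haarProb_of_surjective CubePow.cons CubePow.continuous_cons
        CubePow.surjective_cons hsqc]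
    simp only [integral_const, probReal_univ, one_smul]
    have h1 := integral_sq_le_one hd hhc (hf1 _)
    have h2 : ∀ x, ∫ s : CubePow G d, ∫ v, upperFace f v x s ^ 2 ∂haarProb G
        ∂haarProb (CubePow G d) ≤ 1 := by
      intro x
      have hc : Continuous (Function.uncurry fun (s : CubePow G d) v => upperFace f v x s ^ 2) :=
        (continuous_upperFace hf (by fun_prop) (by fun_prop) (by fun_prop)).pow 2
      rw [integral_swap_of_continuous hc]
      refine le_trans ?_ h1
      rw [← htrans2 x]
      refine integral_mono_of_nonneg (.of_forall fun v => integral_nonneg fun s => sq_nonneg _)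
        (integrable_of_continuous (by fun_prop)) (.of_forall fun v => ?_)
      simp only [upperFace, mul_pow]
      rw [integral_const_mul]
      exact mul_le_of_le_one_right (sq_nonneg _) (integral_prod_sq_le_one hd
        (f := fun η => f (high η.1)) (fun η => hf _) (fun η => hf1 _) (x + v))
    have h3 : ∫ x, ∫ s : CubePow G d, ∫ v, upperFace f v x s ^ 2 ∂haarProb G
        ∂haarProb (CubePow G d) ∂haarProb G ≤ 1 := by
      refine (integral_mono_of_nonneg (.of_forall fun x => integral_nonneg fun s =>
        integral_nonneg fun v => sq_nonneg _) (integrable_const (1 : ℝ))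
        (.of_forall h2)).trans ?_
      simp
    have h4 : ∀ (x : G) (s : CubePow G d), hdm (CubePow.cons (x, s)) = x ∧
        tl (CubePow.cons (x, s)) = s := fun x s => ⟨rfl, rfl⟩
    simp only [(h4 _ _).1, (h4 _ _).2]
    linarith
  rw [← hlhs]
  refine hu.trans ?_
  rw [mul_comm (2 : ℝ)]
  exact mul_le_mul_of_nonneg_left hrhs (Nat.cast_nonneg k)

end Main

theorem eLpNorm_two_le_of_integral_sq_le {X : Type*} [MeasurableSpace X] {μ : Measure X}
    {g : X → ℝ} (hg : AEStronglyMeasurable g μ) (hi : Integrable (fun x => g x ^ 2) μ) {δ : ℝ}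
    (hδ : 0 ≤ δ) (h : ∫ x, g x ^ 2 ∂μ ≤ δ ^ 2) : eLpNorm g 2 μ ≤ ENNReal.ofReal δ := by
  rw [((memLp_two_iff_integrable_sq hg).2 hi).eLpNorm_eq_integral_rpow_norm two_ne_zero
    ENNReal.ofNat_ne_top]
  refine ENNReal.ofReal_le_ofReal ?_
  simp only [ENNReal.toReal_ofNat, Real.rpow_ofNat, Real.norm_eq_abs, sq_abs]
  rw [← one_div, ← Real.sqrt_eq_rpow]
  exact Real.sqrt_le_iff.2 ⟨hδ, h⟩

section Decomposition

variable {G : Type*} [AddCommGroup G] [TopologicalSpace G] [IsTopologicalAddGroup G]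
  [CompactSpace G] [MeasurableSpace G] [BorelSpace G] {d : ℕ}

/-- Samples of a function in the unit ball of `L¹` with small deviation have averages at most
`1 + ε` outside a small set. -/
theorem measureReal_sum_abs_gt_le {h : G → ℝ} (hc : Continuous h)
    (h1 : ∫ v, |h v| ∂haarProb G ≤ 1) {k : ℕ} (hk : 0 < k) {ε : ℝ} (hε : 0 < ε) (u : Fin k → G)
    (hu : ∫ x, (∑ j, (|h (x + u j)| - ∫ v, |h v| ∂haarProb G)) ^ 2 ∂haarProb G ≤ 2 * k) :
    (haarProb G).real {x | k * (1 + ε) < ∑ j, |h (x + u j)|} ≤ 2 / (k * ε ^ 2) := by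
  have hk' : (0 : ℝ) < k := by exact_mod_cast hk
  set D : G → ℝ := fun x => (∑ j, (|h (x + u j)| - ∫ v, |h v| ∂haarProb G)) ^ 2 with hD
  have hDc : Continuous D := by simp only [hD]; fun_prop
  have hD0 : 0 ≤ᵐ[haarProb G] D := .of_forall fun x => sq_nonneg _
  have hM := mul_meas_ge_le_integral_of_nonneg hD0 (integrable_of_continuous hDc) ((k * ε) ^ 2)
  have hsub : {x | k * (1 + ε) < ∑ j, |h (x + u j)|} ⊆ {x | (k * ε) ^ 2 ≤ D x} := by
    intro x hx
    have hx : k * (1 + ε) < ∑ j, |h (x + u j)| := hx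
    have hx0 : 0 ≤ k * ε := by positivity
    refine pow_le_pow_left₀ hx0 ?_ 2
    rw [Finset.sum_sub_distrib]
    simp only [Finset.sum_const, Finset.card_univ, Fintype.card_fin, nsmul_eq_mul]
    nlinarith
  have h2 : (k * ε) ^ 2 * (haarProb G).real {x | k * (1 + ε) < ∑ j, |h (x + u j)|} ≤ 2 * k :=
    (mul_le_mul_of_nonneg_left (measureReal_mono hsub) (by positivity)).trans (hM.trans hu)
  rw [le_div_iff₀ (by positivity)]
  have h3 : (k : ℝ) * ((haarProb G).real {x | k * (1 + ε) < ∑ j, |h (x + u j)|} * (k * ε ^ 2)) ≤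
      k * 2 := by nlinarith
  exact le_of_mul_le_mul_left h3 hk'

theorem exists_decomposition_of_continuous [T2Space G] (hd : 1 ≤ d)
    {f : PuncturedCube (d + 1) → G → ℝ} (hf : ∀ ε, Continuous (f ε))
    (hf1 : ∀ ε, eLpNorm (f ε) (2 ^ d) (haarProb G) ≤ 1) {k m N : ℕ} (hk : 0 < k) (hm : 2 ≤ m)
    {ε : ℝ} (hε : 0 < ε) {S : ℕ → Fin k → ℝ} (hS : ∀ n, ∑ j, |S n j| ≤ k * (1 + ε))
    (hnet : ∀ v : Fin k → ℝ, ∑ j, |v j| ≤ k * (1 + ε) → ∃ n ≤ N, dist (S n) v < ε) :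
    ∃ (X : Fin m → Set G) (ρ : G → ℝ) (φ : Fin m → G → G → ℝ),
      IsAlmostUniformPartition X ∧ Measurable ρ ∧ (∀ x, 0 ≤ ρ x) ∧
      Integrable (fun x => ρ x ^ 2) (haarProb G) ∧
      ∫ x, ρ x ^ 2 ∂haarProb G ≤
        3 * (2 / k + 9 * ε ^ 2 + 4 * (2 / (k * ε ^ 2) + (N + 1 : ℕ) / m)) ∧
      (∀ i t, (∀ x, |φ i t x| ≤ 1) ∧ MemFourierAlgebra d (φ i t) ∧
        fourierAlgebraNorm d (φ i t) ≤ 1) ∧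
      ∀ x t, |cubicProd (d + 1) f (x + t) - ∑ i, (X i).indicator (φ i t) x| + ε ≤ ρ x := by
  classical
  have hk' : (0 : ℝ) < k := by exact_mod_cast hk
  set μ := haarProb G with hμ
  set h := f (high 0) with hh
  have hhc : Continuous h := hf _
  obtain ⟨u, hu⟩ := exists_sample_upperFace hd hf hf1 k
  set v : G → Fin k → ℝ := fun x j => h (x + u j) with hv
  have hvc : Continuous v := by fun_prop
  set κ : G → Fin (N + 1) := fun x => ⟨SimpleFunc.nearestPtInd S N (v x),
    Nat.lt_succ_of_le (SimpleFunc.nearestPtInd_le S N _)⟩ with hκ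
  have hκm : Measurable κ := by
    have h1 : Measurable fun x => SimpleFunc.nearestPtInd S N (v x) :=
      (SimpleFunc.nearestPtInd S N).measurable.comp hvc.measurable
    refine measurable_to_countable' fun b => ?_
    have h2 : κ ⁻¹' {b} = (fun x => SimpleFunc.nearestPtInd S N (v x)) ⁻¹' {(b : ℕ)} := by
      ext x
      simp [hκ, Fin.ext_iff]
    rw [h2]
    exact h1 (measurableSet_singleton _)
  obtain ⟨X, a, B, hX, hBm, hBμ, hXa⟩ := exists_almostUniform hm hκm
  set E : Set G := {x | k * (1 + ε) < ∑ j, |h (x + u j)|} with hE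
  have hEm : MeasurableSet E := (isOpen_lt continuous_const (by fun_prop)).measurableSet
  set R := sampleError f u with hR
  have hRc : Continuous R := continuous_sampleError hf u
  have hR0 : ∀ x, 0 ≤ R x := fun x => integral_nonneg fun s => sq_nonneg _
  set D : G → ℝ := fun x => (∑ j, (|h (x + u j)| - ∫ v, |h v| ∂μ)) ^ 2 with hD
  have hDc : Continuous D := by fun_prop
  have hsplit : ∫ x, R x ∂μ + ∫ x, D x ∂μ ≤ 2 * k :=
    (integral_add (integrable_of_continuous hRc) (integrable_of_continuous hDc)).symm.trans_le hu
  have hRi : ∫ x, R x ∂μ ≤ 2 * k := by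
    have : 0 ≤ ∫ x, D x ∂μ := integral_nonneg fun x => sq_nonneg _
    linarith
  have hDi : ∫ x, D x ∂μ ≤ 2 * k := by
    have : 0 ≤ ∫ x, R x ∂μ := integral_nonneg hR0
    linarith
  have hEμ : μ.real E ≤ 2 / (k * ε ^ 2) :=
    measureReal_sum_abs_gt_le hhc (integral_abs_le_one hhc (hf1 _)) hk hε u hDi
  have hBμ' : μ.real B ≤ (N + 1 : ℕ) / m := by
    have := ENNReal.toReal_mono (ENNReal.div_ne_top (by finiteness) (by simp; omega)) hBμ
    rwa [ENNReal.toReal_div, ENNReal.toReal_natCast, ENNReal.toReal_natCast] at this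
  set A := B ∪ E with hA
  have hAm : MeasurableSet A := hBm.union hEm
  have hAμ : μ.real A ≤ 2 / (k * ε ^ 2) + (N + 1 : ℕ) / m := by
    have := measureReal_union_le (μ := μ) B E
    linarith
  set w : Fin m → Fin k → ℝ := fun i j => S (a i) j / (k * (1 + ε)) with hw
  have hw1 : ∀ i, ∑ j, |w i j| ≤ 1 := fun i => by
    simp only [hw, abs_div, ← Finset.sum_div]
    rw [abs_of_pos (by positivity : (0 : ℝ) < k * (1 + ε))]
    exact (div_le_one (by positivity)).2 (hS _)
  set φ : Fin m → G → G → ℝ := fun i t x => ∑ j, w i j * cubicProd d (fibre f t (u j)) x with hφ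
  have hfibm : ∀ t v η, MemLp (fibre f t v η) (2 ^ (d - 1)) μ := fun t v η =>
    memLp_of_continuous (continuous_fibre hf t v η) _
  have hfib1 : ∀ t v η, eLpNorm (fibre f t v η) (2 ^ (d - 1)) μ ≤ 1 :=
    fun t v η => eLpNorm_fibre_le_one hd hf hf1 t v η
  have hfib : ∀ t v x, |cubicProd d (fibre f t v) x| ≤ 1 := fun t v x =>
    (abs_cubicProd_le_of_continuous hd (continuous_fibre hf t v) x).trans
      (normProd_le_one (hfib1 t v))
  have hφ1 : ∀ i t x, |φ i t x| ≤ 1 := fun i t x => by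
    refine (Finset.abs_sum_le_sum_abs _ _).trans (le_trans (Finset.sum_le_sum fun j _ => ?_) (hw1 i))
    rw [abs_mul]
    exact mul_le_of_le_one_right (abs_nonneg _) (hfib _ _ _)
  have hΦ1 : ∀ y, |cubicProd (d + 1) f y| ≤ 1 := fun y =>
    (abs_cubicProd_le_of_continuous (by omega) hf y).trans (normProd_le_one hf1)
  set ρ : G → ℝ := fun x => √(R x) / k + 3 * ε + A.indicator (fun _ => 2) x with hρ
  have hind : ∀ x, 0 ≤ A.indicator (fun _ => (2 : ℝ)) x := fun x =>
    Set.indicator_nonneg (fun _ _ => by norm_num) x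
  have hρm : Measurable ρ := by
    have h1 : Measurable fun x => √(R x) / k + 3 * ε := by
      have : Continuous fun x => √(R x) / k + 3 * ε := by fun_prop
      exact this.measurable
    exact h1.add (measurable_const.indicator hAm)
  have hρ0 : ∀ x, 0 ≤ ρ x := fun x => by
    have := hind x
    positivity
  set ψ : G → ℝ := fun x => 3 * (R x / k ^ 2 + 9 * ε ^ 2) + A.indicator (fun _ => 12) x with hψ
  have hρψ : ∀ x, ρ x ^ 2 ≤ ψ x := by
    intro x
    have h1 : A.indicator (fun _ => (12 : ℝ)) x = 3 * (A.indicator (fun _ => (2 : ℝ)) x) ^ 2 := by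
      by_cases hx : x ∈ A <;> simp [hx]; norm_num
    have h2 : (√(R x) / k) ^ 2 = R x / k ^ 2 := by rw [div_pow, Real.sq_sqrt (hR0 x)]
    simp only [hρ, hψ]
    rw [h1, ← h2]
    generalize √(R x) / k = p
    generalize A.indicator (fun _ => (2 : ℝ)) x = q
    nlinarith [sq_nonneg (p - 3 * ε), sq_nonneg (p - q), sq_nonneg (3 * ε - q)]
  have hψ1 : Integrable (fun x => 3 * (R x / k ^ 2 + 9 * ε ^ 2)) μ :=
    integrable_of_continuous (by fun_prop)
  have hψ2 : Integrable (fun x => A.indicator (fun _ => (12 : ℝ)) x) μ :=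
    (integrable_const _).indicator hAm
  have hψi : Integrable ψ μ := hψ1.add hψ2
  have hρi : Integrable (fun x => ρ x ^ 2) μ :=
    hψi.mono' (hρm.pow_const 2).aestronglyMeasurable (.of_forall fun x => by
      rw [Real.norm_eq_abs, abs_of_nonneg (sq_nonneg _)]
      exact hρψ x)
  refine ⟨X, ρ, φ, hX, hρm, hρ0, hρi, ?_, fun i t => ⟨hφ1 i t, ?_⟩, fun x t => ?_⟩
  · refine (integral_mono hρi hψi hρψ).trans ?_
    have h1 : ∫ x, ψ x ∂μ = 3 * ((∫ x, R x ∂μ) / k ^ 2 + 9 * ε ^ 2) + μ.real A * 12 := by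
      rw [show ∫ x, ψ x ∂μ = _ from integral_add hψ1 hψ2, integral_const_mul,
        integral_add ((integrable_of_continuous hRc).div_const _) (integrable_const _),
        integral_div, integral_indicator_const _ hAm]
      simp
    have h2 : (∫ x, R x ∂μ) / k ^ 2 ≤ 2 / k := by
      rw [div_le_div_iff₀ (by positivity) hk']
      nlinarith
    rw [h1]
    linarith
  · obtain ⟨h1, h2⟩ := memFourierAlgebra_sum hd (fun j η => hfibm t (u j) η)
      (fun j η => hfib1 t (u j) η) (w i)
    exact ⟨h1, h2.trans (hw1 i)⟩
  · obtain ⟨i, hi⟩ := Set.mem_iUnion.1 (hX.iUnion_eq ▸ Set.mem_univ x)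
    have hsum : ∑ i, (X i).indicator (φ i t) x = φ i t x := by
      rw [Finset.sum_eq_single i, Set.indicator_of_mem hi]
      · intro j _ hj
        exact Set.indicator_of_notMem
          (fun hxj => Set.disjoint_left.1 (hX.pairwise_disjoint hj) hxj hi) _
      · simp
    rw [hsum]
    have hsq0 : 0 ≤ √(R x) / k := by positivity
    by_cases hxA : x ∈ A
    · have h1 := abs_sub (cubicProd (d + 1) f (x + t)) (φ i t x)
      have h2 := hΦ1 (x + t)
      have h3 := hφ1 i t x
      simp only [hρ, Set.indicator_of_mem hxA]
      linarith
    · have hxB : x ∉ B := fun hx => hxA (Or.inl hx)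
      have hxE : ∑ j, |v x j| ≤ k * (1 + ε) := not_lt.1 fun hx => hxA (Or.inr hx)
      have hdist : ∀ j, |v x j - S (a i) j| ≤ ε := by
        obtain ⟨n, hn, hnv⟩ := hnet (v x) hxE
        have h1 := SimpleFunc.edist_nearestPt_le S (v x) hn
        have h2 : SimpleFunc.nearestPt S N (v x) = S (a i) := by
          rw [← hXa i x hi hxB]; rfl
        rw [h2, edist_dist, edist_dist, ENNReal.ofReal_le_ofReal_iff dist_nonneg] at h1
        intro j
        rw [abs_sub_comm, ← Real.dist_eq]
        exact (dist_le_pi_dist _ _ j).trans (h1.trans hnv.le)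
      have hcoef : ∑ j, |v x j / k - w i j| ≤ 2 * ε := by
        have h1 : ∀ j, |v x j / k - w i j| ≤ ε / k + ε * |w i j| := fun j => by
          have h2 : v x j / k - w i j = (v x j - S (a i) j) / k + ε * w i j := by
            simp only [hw]
            field_simp
            ring
          rw [h2]
          refine (abs_add_le _ _).trans (add_le_add ?_ ?_)
          · rw [abs_div, abs_of_pos hk']
            exact div_le_div_of_nonneg_right (hdist j) hk'.le
          · rw [abs_mul, abs_of_pos hε]
        refine (Finset.sum_le_sum fun j _ => h1 j).trans ?_
        rw [Finset.sum_add_distrib, ← Finset.mul_sum]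
        simp only [Finset.sum_const, Finset.card_univ, Fintype.card_fin, nsmul_eq_mul]
        rw [mul_div_cancel₀ _ hk'.ne']
        nlinarith [hw1 i]
      have hsamp := abs_cubicProd_sub_sum_le hd hf hf1 u x t
      have h1 : |∑ j, v x j / k * cubicProd d (fibre f t (u j)) x - cubicProd (d + 1) f (x + t)| ≤
          √(R x) / k := by
        have h2 : ∑ j, v x j / k * cubicProd d (fibre f t (u j)) x - cubicProd (d + 1) f (x + t) =
            (∑ j, v x j * cubicProd d (fibre f t (u j)) x - k * cubicProd (d + 1) f (x + t)) / k := by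
          rw [sub_div, Finset.sum_div, mul_div_cancel_left₀ _ hk'.ne']
          congr 1
          exact Finset.sum_congr rfl fun j _ => by ring
        rw [h2, abs_div, abs_of_pos hk']
        exact div_le_div_of_nonneg_right hsamp hk'.le
      have h2 : |∑ j, v x j / k * cubicProd d (fibre f t (u j)) x - φ i t x| ≤ 2 * ε := by
        simp only [hφ, ← Finset.sum_sub_distrib, ← sub_mul]
        refine (Finset.abs_sum_le_sum_abs _ _).trans
          (le_trans (Finset.sum_le_sum fun j _ => ?_) hcoef)
        rw [abs_mul]
        exact mul_le_of_le_one_right (abs_nonneg _) (hfib _ _ _)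
      have h3 : |cubicProd (d + 1) f (x + t) - φ i t x| ≤ √(R x) / k + 2 * ε := by
        rw [abs_le] at h1 h2 ⊢
        constructor <;> linarith
      simp only [hρ, Set.indicator_of_notMem hxA]
      linarith

end Decomposition

/-- A choice of the parameters of the decomposition in terms of the target error. -/
theorem exists_parameters {δ : ℝ} (hδ : 0 < δ) :
    ∃ (ε : ℝ) (k N m : ℕ) (S : ℕ → Fin k → ℝ), 0 < ε ∧ 0 < k ∧ 2 ≤ m ∧
      (∀ n, ∑ j, |S n j| ≤ k * (1 + ε)) ∧
      (∀ v : Fin k → ℝ, ∑ j, |v j| ≤ k * (1 + ε) → ∃ n ≤ N, dist (S n) v < ε) ∧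
      3 * (2 / k + 9 * ε ^ 2 + 4 * (2 / (k * ε ^ 2) + (N + 1 : ℕ) / m)) ≤ δ ^ 2 := by
  set ε := δ / 8 with hε
  have hε0 : 0 < ε := by positivity
  obtain ⟨k, hk⟩ := exists_nat_gt ((6 + 24 / ε ^ 2) * 4 / δ ^ 2)
  have hk0 : (0 : ℝ) < k := lt_of_le_of_lt (by positivity) hk
  obtain ⟨N, S, hS, hnet⟩ := exists_finite_net k (R := k * (1 + ε)) (by positivity) hε0
  obtain ⟨m, hm⟩ := exists_nat_gt (48 * (N + 1 : ℕ) / δ ^ 2)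
  have hm0 : (0 : ℝ) < m := lt_of_le_of_lt (by positivity) hm
  refine ⟨ε, k, N, m + 2, S, hε0, by exact_mod_cast hk0, by omega, hS, hnet, ?_⟩
  have h1 : 6 / k + 24 / (k * ε ^ 2) ≤ δ ^ 2 / 4 := by
    have : 6 / k + 24 / (k * ε ^ 2) = (6 + 24 / ε ^ 2) / k := by field_simp
    rw [this, div_le_iff₀ hk0]
    rw [div_lt_iff₀ (by positivity)] at hk
    linarith
  have h2 : 12 * ((N + 1 : ℕ) / ((m + 2 : ℕ) : ℝ)) ≤ δ ^ 2 / 4 := by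
    rw [← mul_div_assoc, div_le_iff₀ (by positivity)]
    rw [div_lt_iff₀ (by positivity)] at hm
    push_cast at hm ⊢
    nlinarith [sq_nonneg δ]
  have h3 : 3 * (2 / (k : ℝ) + 9 * ε ^ 2 + 4 * (2 / (k * ε ^ 2) + (N + 1 : ℕ) / ((m + 2 : ℕ) : ℝ))) =
      (6 / k + 24 / (k * ε ^ 2)) + 27 * ε ^ 2 + 12 * ((N + 1 : ℕ) / ((m + 2 : ℕ) : ℝ)) := by ring
  rw [h3]
  have h4 : 27 * ε ^ 2 ≤ δ ^ 2 / 2 := by rw [hε]; nlinarith [sq_nonneg δ]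
  linarith

end CubicConvolution

open CubicConvolution in
theorem mainTheorem1 (d : ℕ) (hd : 1 ≤ d) (δ : ℝ) (hδ : 0 < δ) :
    ∃ M : ℕ, 2 ≤ M ∧ ∃ C : ℝ, 0 < C ∧
      ∀ (Z : Type*) [AddCommGroup Z] [TopologicalSpace Z] [IsTopologicalAddGroup Z]
        [CompactSpace Z] [T2Space Z] [MeasurableSpace Z] [BorelSpace Z]
        (f : CubicConvolution.PuncturedCube (d + 1) → Z → ℝ),
        (∀ ε, MemLp (f ε) (2 ^ d) (CubicConvolution.haarProb Z)) →
        (∀ ε, eLpNorm (f ε) (2 ^ d) (CubicConvolution.haarProb Z) ≤ 1) →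
        ∃ (m : ℕ) (X : Fin m → Set Z) (ρ : Z → ℝ) (φ : Fin m → Z → Z → ℝ),
          m ≤ M ∧
          CubicConvolution.IsAlmostUniformPartition X ∧
          Measurable ρ ∧ (∀ x, 0 ≤ ρ x) ∧
          eLpNorm ρ 2 (CubicConvolution.haarProb Z) ≤ ENNReal.ofReal δ ∧
          (∀ i t, eLpNorm (φ i t) ∞ (CubicConvolution.haarProb Z) ≤ 1 ∧
            CubicConvolution.MemFourierAlgebra d (φ i t) ∧
            CubicConvolution.fourierAlgebraNorm d (φ i t) ≤ C) ∧
          ∀ x t, |CubicConvolution.cubicProd (d + 1) f (x + t) -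
            ∑ i, (X i).indicator (φ i t) x| ≤ ρ x := by
  obtain ⟨ε, k, N, m, S, hε, hk, hm, hS, hnet, hpar⟩ := exists_parameters hδ
  refine ⟨m, hm, 1, one_pos, ?_⟩
  intro Z _ _ _ _ _ _ _ f hf hf1
  set n : ℝ := ((Fintype.card (PuncturedCube (d + 1)) : ℕ) : ℝ) with hn
  have hn0 : 0 ≤ n := Nat.cast_nonneg _
  have hη : 0 < ε / (2 * (n + 1)) := by positivity
  choose c hc hc1 hfc using fun e => exists_continuous_eLpNorm_le_one (p := 2 ^ d) (hf e)
    (by finiteness) (one_le_two_pow_ennreal d) (hf1 e) hη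
  obtain ⟨X, ρ, φ, hX, hρm, hρ0, hρi, hρ, hφ, hdec⟩ :=
    exists_decomposition_of_continuous hd hc hc1 hk hm hε hS hnet
  refine ⟨m, X, ρ, φ, le_rfl, hX, hρm, hρ0, eLpNorm_two_le_of_integral_sq_le
    hρm.aestronglyMeasurable hρi hδ.le (hρ.trans hpar), fun i t => ⟨?_, (hφ i t).2⟩, fun x t => ?_⟩
  · rw [eLpNorm_exponent_top]
    refine (eLpNormEssSup_le_of_ae_bound (C := 1) (.of_forall fun x => (hφ i t).1 x)).trans ?_
    simp
  · have h1 := abs_cubicProd_sub_le (d := d + 1) (by omega) hf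
      (fun e => memLp_of_continuous (hc e) (2 ^ d)) hf1 hc1
      (η := 2 * (ε / (2 * (n + 1)))) (by positivity) hfc (x + t)
    have h2 : n * (2 * (ε / (2 * (n + 1)))) ≤ ε := by
      rw [mul_div_assoc', mul_div_mul_left _ _ two_ne_zero, mul_div_assoc',
        div_le_iff₀ (by positivity)]
      nlinarith
    have h3 := hdec x t
    have h4 := abs_sub_le (cubicProd (d + 1) f (x + t)) (cubicProd (d + 1) c (x + t))
      (∑ i, (X i).indicator (φ i t) x)
    linarith
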